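/- **Setting.** Let $q=(\rho,\rho \vec u,\rho e)\in\mathbb R^5$, $\rho e=\frac{p}{\gamma-1}+\frac12\rho|\vec u|^2$, $p=\rho RT$, with $\gamma>1$, $R>0$, Prandtl number $\mathrm{Pr}>0$ and viscosity $\mu\ge 0$. Let $f_e$ be the inviscid fluxes of the compressible Navier–Stokes equations and let $\mathcal E$ be one of * the kinetic energy $\mathcal K=\frac12\rho|\vec u|^2$, $w=\partial_q\mathcal K=(-\frac12|\vec u|^2,\vec u,0)$, $\Theta=1$; * the thermodynamic entropy $\mathcal S=-\rho s/(\gamma-1)$, $s=\ln p-\gamma\ln\rho$, $w=\partial_q\mathcal S=\big(\frac{\gamma-s}{\gamma-1}-\frac{\rho|\vec u|^2}{2p},\frac{\rho\vec u}{p},-\frac{\rho}{p}\big)$, $\Theta=0$; with entropy flux $\vec F^{\mathcal E}_e=\mathcal E\,\vec u$. Consider a conforming (possibly periodic) mesh of curved hexahedra, each the image of $E=[-1,1]^3$, with tensor-product Gauss–Lobatto nodes of order $N\ge1$ and weights $w_{ijk}$, derivative matrix $D_{ij}=l_j'(\xi_i)$, metric terms $J\vec a^i$ computed from the nodal mapping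 in the conservative curl form $(J\vec a^i)_n=-(\nabla_\xi\times I^N(X_l\nabla_\xi X_m))_i$, $(n,m,l)$ cyclic, nodal Jacobian $\mathcal J=\vec a_1\cdot(\vec a_2\times\vec a_3)>0$, and $\vec n^+dS^+=-\vec n^-dS^-$ at interior faces. All boundary faces are free-slip or no-slip adiabatic walls. $\langle\cdot,\cdot\rangle_{E,N}$ and $\int_{\partial e,N}$ are the nodal quadratures, $\tilde F^i=J\vec a^i\cdot F$, $[\![a]\!]=a_R-a_L$, $\{\!\{a\}\!\}=\frac12(a_L+a_R)$. **Scheme.** On a time interval $I$, nodal fields $Q$ (with $\rho,p>0$) and $G$, with $W=w(Q)$, satisfy in every element, for all nodal test fields $\phi,\varphi$, $$\langle\mathcal JQ_t,\phi\rangle_{E,N}+\int_{\partial e,N}\phi^T(F_e^\star-F_e)\cdot\vec n\,dS+\langle\mathbb D(F_e^\#),\phi\rangle_{E,N}=\int_{\partial e,N}\phi^T(F_v^\star+F_a^{\mathcal F,\star})\cdot\vec n\,dS-\langle\tilde F_v+\tilde F_a^{\mathcal F},\nabla_\xi\phi\rangle_{E,N},$$ $$\langle\mathcal JG,\varphi\rangle_{E,N}=\int_{\partial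 e,N}W^{\star T}\varphi\cdot\vec n\,dS-\langle W,\nabla_\xi\cdot\tilde\varphi\rangle_{E,N}.$$ Here: * $\mathbb D(F_e^\#)$ is the split-form divergence (coefficients $2D_{ij}$, arithmetic means of the metric terms) with two-point flux $F^\#$ equal, in direction $d$, to Pirozzoli's $\big(m_d,\ m_d\{\!\{\vec u\}\!\}+\{\!\{p\}\!\}\vec e_d,\ m_d\{\!\{h\}\!\}\big)$, $m_d=\{\!\{\rho\}\!\}\{\!\{u_d\}\!\}$, $h=e+p/\rho$, if $\mathcal E=\mathcal K$, and to Chandrashekar's $\big(m_d,\ m_d\{\!\{\vec u\}\!\}+\bar p\,\vec e_d,\ m_d(\tfrac{1}{2(\gamma-1)\beta^{\ln}}-\tfrac12\{\!\{|\vec u|^2\}\!\}+|\{\!\{\vec u\}\!\}|^2)+\bar p\{\!\{u_d\}\!\}\big)$, $m_d=\rho^{\ln}\{\!\{u_d\}\!\}$, $\beta=\frac{\rho}{2p}$, $\bar p=\frac{\{\!\{\rho\}\!\}}{2\{\!\{\beta\}\!\}}$ ($a^{\ln}$ is the logarithmic mean), if $\mathcal E=\mathcal S$. * $F_e^\star\cdot\vec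 n$ is either entropy conserving, $F^\#(Q_L,Q_R)\cdot\vec n$, or dissipative, $F^\#(Q_L,Q_R)\cdot\vec n-\frac12\delta$. For $\mathcal K$: $\delta=\lambda_{\max}[\![Q]\!]$ (Lax–Friedrichs, $\lambda_{\max}$ the larger of the two values of $|\vec u\cdot\vec n|+\sqrt{\gamma p/\rho}$). For $\mathcal S$: $\delta=M[\![W]\!]$, $M=\mathcal R|\Lambda|\mathcal S_c\mathcal R^T$, where $\mathcal R,\Lambda$ are the eigenvectors and eigenvalues of the Euler flux Jacobian in the direction $\vec n$ and $\mathcal S_c$ is the diagonal scaling with $\mathcal R\mathcal S_c\mathcal R^T=\partial q/\partial w$, all at velocity $\{\!\{\vec u\}\!\}$ and at symmetric positive averages $\hat\rho,\hat p$ of densities and pressures. * $F_v$ is the Navier–Stokes viscous flux, with velocity and temperature gradients recovered from $G$ (for $\mathcal K$, whose variables do not contain $T$, any discrete temperature gradient may be used). * $F_a^{\mathcal F}$ is one of $$\text{(SVV2)}\quad\sqrt{\tfrac{\alpha}{\mathcal J}}\;C\,\mathcal F\star\big(\sqrt{\mathcal J\alpha}\,G\big),\qquad\text{(SVV3)}\quad\tfrac1{\sqrt{\mathcal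 J}}L^T\sqrt D\,\mathcal F\star\big(\sqrt{\mathcal JD}\,L\,G\big),$$ with $\alpha\ge0$ a nodal field and $C\in\mathbb R^{15\times15}$ constant symmetric positive semidefinite (unfiltered flux $\alpha CG$), resp. $L$ a nodal field of $15\times15$ matrices and $D\ge0$ one of diagonal matrices (unfiltered flux $L^TDL\,G$). For $\mathcal K$, an arbitrary flux may be added in the energy component. $\mathcal F\star$ multiplies the Legendre modes of a nodal polynomial by coefficients $\hat{\mathcal F}_{ijk}\ge0$, element by element. * At interior faces $W^\star=\{\!\{W\}\!\}$, $F_v^\star=\{\!\{F_v\}\!\}$, $F_a^{\mathcal F,\star}=\{\!\{F_a^{\mathcal F}\}\!\}$ (BR1). At walls $F_e^\star$ is the interface flux with the ghost state of reversed normal velocity; at a free-slip wall $W^\star=W$ and $F_v^\star\cdot\vec n=F_a^{\mathcal F,\star}\cdot\vec n=0$; at a no-slip wall $W^\star=(W_1,0,0,0,W_5)$ and $F^\star\cdot\vec n$ is $F\cdot\vec n$ with first and fifth components set to zero, for $F=F_v,F_a^{\mathcal F}$. **Notation.** $\langle\mathcal E_t\rangle^N=\frac{d}{dt}\sum_e\langle\mathcal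 J\mathcal E(Q)\rangle_{E,N}$; $\langle D_v\rangle^{E,N}=\langle\mathcal JG,F_v\rangle_{E,N}$; $\langle D_a\rangle^{E,N}=\langle\mathcal JG,F_a^{\mathcal F}\rangle_{E,N}$; $\mathcal W_p$ (per element) is the quadrature of $\vec u$ times the pressure part of the split-form divergence built on $\{\!\{p\}\!\}$; $\mathcal W_p^{\mathrm{int}}=\sum_{\text{int. faces}}\int_{f,N}\{\!\{\vec u\}\!\}\cdot\vec n_L[\![p]\!]\,dS$ is the work of the pressure jumps. Further $$\mathrm{IBT}_e=-\sum_{\text{int. faces}}\int_{f,N}\big([\![\vec F_e^{\mathcal E}]\!]+[\![W]\!]^TF_e^\star-[\![W^TF_e]\!]\big)\cdot\vec n_L\,dS,\qquad\mathrm{PBT}_e=\sum_{\text{bdry faces}}\int_{f,N}\big(\vec F_e^{\mathcal E}+W^TF_e^\star-W^TF_e\big)\cdot\vec n\,dS,$$ and for $F=F_v,F_a^{\mathcal F}$ (giving $\mathrm{IBT}_v,\mathrm{PBT}_v$ and $\mathrm{IBT}_a,\mathrm{PBT}_a$) $$\mathrm{IBT}=\sum_{\text{int. faces}}\int_{f,N}\big([\![W]\!]^TF^\star+W^{\star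 T}[\![F]\!]-[\![W^TF]\!]\big)\cdot\vec n_L\,dS,\qquad\mathrm{PBT}=-\sum_{\text{bdry faces}}\int_{f,N}\big(W^TF^\star+W^{\star T}F-W^TF\big)\cdot\vec n\,dS .$$ **Theorem (semi-discrete entropy stability of the filtered scheme).** At every time in $I$, $$\langle\mathcal E_t\rangle^N+\Theta\sum_e\mathcal W_p=-\mathrm{IBT}_e-\mathrm{PBT}_e-\sum_e\langle D_v\rangle^{E,N}-\sum_e\langle D_a\rangle^{E,N},$$ where 1. $\mathrm{IBT}_e-\Theta\,\mathcal W_p^{\mathrm{int}}\ge0$ and $\mathrm{PBT}_e\ge0$, both with equality for the entropy-conserving interface flux; 2. $\langle D_v\rangle^{E,N}\ge0$ and $\langle D_a\rangle^{E,N}\ge0$ in every element; 3. $\mathrm{IBT}_v=\mathrm{IBT}_a=0$ and $\mathrm{PBT}_v=\mathrm{PBT}_a=0$. Consequently $\langle\mathcal E_t\rangle^N+\Theta\big(\sum_e\mathcal W_p+\mathcal W_p^{\mathrm{int}}\big)\le0$. In particular, for the thermodynamic entropy ($\Theta=0$), $\mathrm{IBT}_e\ge0$ and the total discrete entropy $\sum_e\langle\mathcal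 J\mathcal S(Q)\rangle_{E,N}$ is nonincreasing on $I$. -/

import Mathlib

open Polynomial Finset

noncomputable section

namespace DGSEM

/-! ### One-dimensional Gauss–Lobatto nodes, weights and derivative matrix -/

/-- The Lagrange polynomial `l_i` of the nodes `ξ`. -/
def lagr {N : ℕ} (ξ : Fin (N + 1) → ℝ) (i : Fin (N + 1)) : ℝ[X] :=
  Lagrange.basis Finset.univ ξ i

/-- The quadrature weight `w_i = ∫_{-1}^{1} l_i`. -/
def wt {N : ℕ} (ξ : Fin (N + 1) → ℝ) (i : Fin (N + 1)) : ℝ :=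
  ∫ x in (-1 : ℝ)..1, (lagr ξ i).eval x

/-- The derivative matrix `D_{ij} = l_j'(ξ_i)`. -/
def dMat {N : ℕ} (ξ : Fin (N + 1) → ℝ) (i j : Fin (N + 1)) : ℝ :=
  (derivative (lagr ξ j)).eval (ξ i)

/-- `ξ` lists, in increasing order, the `N + 1` Gauss–Lobatto points of `[-1, 1]`: both end points
are nodes and the interpolatory quadrature is exact on polynomials of degree at most `2 N - 1`.
(The end-point conditions force `1 ≤ N`.) -/
def IsGaussLobatto {N : ℕ} (ξ : Fin (N + 1) → ℝ) : Prop :=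
  StrictMono ξ ∧ ξ 0 = -1 ∧ ξ (Fin.last N) = 1 ∧
    ∀ f : ℝ[X], f.natDegree < 2 * N →
      ∫ x in (-1 : ℝ)..1, f.eval x = ∑ i, wt ξ i * f.eval (ξ i)

/-- The Legendre polynomial `L_k` (Rodrigues' formula). -/
def legendre (k : ℕ) : ℝ[X] :=
  C (1 / (2 ^ k * (k.factorial : ℝ))) * derivative^[k] ((X ^ 2 - 1) ^ k)

/-- The discrete squared norm `‖L_k‖_N²`. -/
def legNormSq {N : ℕ} (ξ : Fin (N + 1) → ℝ) (k : Fin (N + 1)) : ℝ :=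
  ∑ i, wt ξ i * (legendre k).eval (ξ i) ^ 2

/-! ### Tensor-product nodes of the reference cube -/

/-- A node of the reference cube, `(i, j, k)`; the same triples index the Legendre modes. -/
abbrev Node (N : ℕ) := Fin 3 → Fin (N + 1)

/-- A node of a face of the reference cube. -/
abbrev FNode (N : ℕ) := Fin 2 → Fin (N + 1)

/-- The node of the cube at the point `y` of the face `ξ^d = 1` (`s = true`) or `ξ^d = -1`
(`s = false`); `y` lists the two remaining indices in increasing order of the direction. -/
def faceNode {N : ℕ} (d : Fin 3) (s : Bool) (y : FNode N) : Node N :=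
  Fin.insertNth (α := fun _ => Fin (N + 1)) d (if s then Fin.last N else 0) y

/-- The volume weight `w_i w_j w_k`. -/
def wt3 {N : ℕ} (ξ : Fin (N + 1) → ℝ) (x : Node N) : ℝ := ∏ d, wt ξ (x d)

/-- The surface weight `w_i w_j`. -/
def wt2 {N : ℕ} (ξ : Fin (N + 1) → ℝ) (y : FNode N) : ℝ := ∏ a, wt ξ (y a)

/-- The nodal values of `∂ f / ∂ ξ^d` for the polynomial with nodal values `f`. -/
def pd {N : ℕ} (ξ : Fin (N + 1) → ℝ) (d : Fin 3) (f : Node N → ℝ) (x : Node N) : ℝ :=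
  ∑ n, dMat ξ (x d) n * f (Function.update x d n)

/-- The modal coefficient of `L_p(ξ) L_q(η) L_r(ζ)`, `m = (p, q, r)`, of the polynomial with nodal
values `f` (the forward transform). -/
def modal {N : ℕ} (ξ : Fin (N + 1) → ℝ) (f : Node N → ℝ) (m : Node N) : ℝ :=
  (∑ x, wt3 ξ x * f x * ∏ d, (legendre (m d)).eval (ξ (x d))) / ∏ d, legNormSq ξ (m d)

/-- The nodal values of `𝓕 ⋆ f` for the filter kernel with modal coefficients `K`. -/
def filt {N : ℕ} (ξ : Fin (N + 1) → ℝ) (K : Node N → ℝ) (f : Node N → ℝ) (x : Node N) : ℝ :=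
  ∑ m, K m * modal ξ f m * ∏ d, (legendre (m d)).eval (ξ (x d))

/-! ### Geometry of an element, from the nodal values `X` of its mapping -/

/-- The covariant basis `a_i = ∂ X / ∂ ξ^i`. -/
def cov {N : ℕ} (ξ : Fin (N + 1) → ℝ) (X : Node N → Fin 3 → ℝ) (i : Fin 3) (x : Node N) :
    Fin 3 → ℝ :=
  fun n => pd ξ i (fun z => X z n) x

/-- The Jacobian `J = a_1 · (a_2 × a_3)`. -/
def jac {N : ℕ} (ξ : Fin (N + 1) → ℝ) (X : Node N → Fin 3 → ℝ) (x : Node N) : ℝ :=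
  cov ξ X 0 x ⬝ᵥ crossProduct (cov ξ X 1 x) (cov ξ X 2 x)

/-- The `n`-th Cartesian component of the contravariant vector `J a^i`, in the conservative curl
form `(J a^i)_n = - (∇_ξ × I^N (X_l ∇_ξ X_m))_i`, `(n, m, l)` cyclic. -/
def contra {N : ℕ} (ξ : Fin (N + 1) → ℝ) (X : Node N → Fin 3 → ℝ) (i n : Fin 3) (x : Node N) : ℝ :=
  -(pd ξ (i + 1) (fun z => X z (n + 2) * pd ξ (i + 2) (fun z' => X z' (n + 1)) z) x
    - pd ξ (i + 2) (fun z => X z (n + 2) * pd ξ (i + 1) (fun z' => X z' (n + 1)) z) x)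

/-- The vector `n dS`, without the quadrature weight, at the point `y` of the face `(d, s)`; `n` is
the outward unit normal. -/
def nvec {N : ℕ} (ξ : Fin (N + 1) → ℝ) (X : Node N → Fin 3 → ℝ) (d : Fin 3) (s : Bool)
    (y : FNode N) : Fin 3 → ℝ :=
  fun n => (if s then 1 else -1) * contra ξ X d n (faceNode d s y)

/-- The symmetry of the square that permutes the two coordinates by `σ` and then reverses those
marked by `r`. -/
def squareSymm (N : ℕ) (σ : Equiv.Perm (Fin 2)) (r : Fin 2 → Bool) : FNode N ≃ FNode N :=
  (Equiv.arrowCongr σ.symm (Equiv.refl (Fin (N + 1)))).trans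
    (Equiv.piCongrRight fun a => if r a then Fin.revPerm else Equiv.refl (Fin (N + 1)))

/-- A face of an element: the element, the reference direction normal to the face, and its side. -/
abbrev EFace (E : Type*) := E × Fin 3 × Bool

/-- A conforming mesh of curved hexahedra with elements `E`, interior faces `Fi` and boundary faces
`Fb`. -/
structure Mesh (N : ℕ) (ξ : Fin (N + 1) → ℝ) (E Fi Fb : Type*) where
  /-- nodal values of the element mappings -/
  X : E → Node N → Fin 3 → ℝ
  /-- Every element face is exactly one of: the left side of an interior face, the right side of
  an interior face, a boundary face. -/
  faces : (Fi ⊕ Fi) ⊕ Fb ≃ EFace E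
  /-- The relative orientation of the two sides: the point `y` on the left is the point
  `squareSymm N (perm i) (rev i) y` on the right. -/
  perm : Fi → Equiv.Perm (Fin 2)
  rev : Fi → Fin 2 → Bool
  jac_pos : ∀ e x, 0 < jac ξ (X e) x
  /-- The two sides of an interior face coincide in space, possibly up to a translation (periodic
  meshes). -/
  conform : ∀ i, ∃ c : Fin 3 → ℝ, ∀ y,
    X (faces (.inl (.inr i))).1 (faceNode (faces (.inl (.inr i))).2.1 (faces (.inl (.inr i))).2.2
        (squareSymm N (perm i) (rev i) y))
      = X (faces (.inl (.inl i))).1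
          (faceNode (faces (.inl (.inl i))).2.1 (faces (.inl (.inl i))).2.2 y) + c
  /-- The elements lie on opposite sides of an interior face: `n⁺ dS⁺ = - n⁻ dS⁻`. -/
  opposite : ∀ i y,
    nvec ξ (X (faces (.inl (.inr i))).1) (faces (.inl (.inr i))).2.1 (faces (.inl (.inr i))).2.2
        (squareSymm N (perm i) (rev i) y)
      = -nvec ξ (X (faces (.inl (.inl i))).1) (faces (.inl (.inl i))).2.1
          (faces (.inl (.inl i))).2.2 y

/-! ### The gas -/

/-- The state `(ρ, ρu, ρv, ρw, ρe)`; also used for vectors of entropy variables. -/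
abbrev State := Fin 5 → ℝ

/-- A block vector: three stacked state vectors. -/
abbrev Block := Fin 3 → State

def pack (a : ℝ) (m : Fin 3 → ℝ) (b : ℝ) : State := ![a, m 0, m 1, m 2, b]

/-- The three middle components of a state vector. -/
def mid (q : State) : Fin 3 → ℝ := ![q 1, q 2, q 3]

def vel (q : State) : Fin 3 → ℝ := fun i => mid q i / q 0

/-- The kinetic energy `ρ |u|² / 2`. -/
def kin (q : State) : ℝ := q 0 * (vel q ⬝ᵥ vel q) / 2

/-- The pressure, from `ρe = p / (γ - 1) + ρ |u|² / 2`. -/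
def pres (γ : ℝ) (q : State) : ℝ := (γ - 1) * (q 4 - kin q)

/-- The total specific enthalpy `h = e + p / ρ`. -/
def enth (γ : ℝ) (q : State) : ℝ := (q 4 + pres γ q) / q 0

def sound (γ : ℝ) (q : State) : ℝ := √(γ * pres γ q / q 0)

def Admissible (γ : ℝ) (q : State) : Prop := 0 < q 0 ∧ 0 < pres γ q

/-- The inviscid fluxes. -/
def eulerFlux (γ : ℝ) (q : State) : Block := fun d =>
  pack (q 0 * vel q d)
    (fun i => q 0 * vel q d * vel q i + if i = d then pres γ q else 0)
    (q 0 * enth γ q * vel q d)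

/-- The two entropies: kinetic energy and (minus) thermodynamic entropy. -/
inductive EntropyKind
  | kinetic
  | thermo

/-- `Θ`. -/
def EntropyKind.theta : EntropyKind → ℝ
  | .kinetic => 1
  | .thermo => 0

/-- The specific physical entropy `s = ln p - γ ln ρ`. -/
def physEntropy (γ : ℝ) (q : State) : ℝ := Real.log (pres γ q) - γ * Real.log (q 0)

/-- The entropy `𝓔`. -/
def entropy (γ : ℝ) : EntropyKind → State → ℝ
  | .kinetic, q => kin q
  | .thermo, q => -(q 0 * physEntropy γ q) / (γ - 1)

/-- The entropy variables `w = ∂𝓔/∂q`. -/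
def entVar (γ : ℝ) : EntropyKind → State → State
  | .kinetic, q => pack (-(vel q ⬝ᵥ vel q) / 2) (vel q) 0
  | .thermo, q =>
      pack ((γ - physEntropy γ q) / (γ - 1) - q 0 * (vel q ⬝ᵥ vel q) / (2 * pres γ q))
        (fun i => q 0 * vel q i / pres γ q) (-(q 0 / pres γ q))

/-- The inviscid entropy flux: `ρ |u|² u / 2` or `𝓢 u`. -/
def entFlux (γ : ℝ) (k : EntropyKind) (q : State) : Fin 3 → ℝ := fun d => entropy γ k q * vel q d

/-! ### Two-point inviscid fluxes -/

def avg (a b : ℝ) : ℝ := (a + b) / 2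

def logMean (a b : ℝ) : ℝ := if a = b then a else (b - a) / (Real.log b - Real.log a)

/-- Pirozzoli's kinetic-energy-preserving two-point flux. -/
def pirozzoli (γ : ℝ) (q r : State) : Block := fun d =>
  let m := avg (q 0) (r 0) * avg (vel q d) (vel r d)
  pack m
    (fun i => m * avg (vel q i) (vel r i) + if i = d then avg (pres γ q) (pres γ r) else 0)
    (m * avg (enth γ q) (enth γ r))

/-- Chandrashekar's entropy-conserving two-point flux, with `β = ρ / (2 p)`. -/
def chandrashekar (γ : ℝ) (q r : State) : Block := fun d =>
  let β : State → ℝ := fun s => s 0 / (2 * pres γ s)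
  let u : Fin 3 → ℝ := fun i => avg (vel q i) (vel r i)
  let m := logMean (q 0) (r 0) * u d
  let p := avg (q 0) (r 0) / (2 * avg (β q) (β r))
  pack m
    (fun i => m * u i + if i = d then p else 0)
    (m * (1 / (2 * (γ - 1) * logMean (β q) (β r))
        - avg (vel q ⬝ᵥ vel q) (vel r ⬝ᵥ vel r) / 2 + u ⬝ᵥ u) + p * u d)

/-- The two-point volume flux of the scheme. -/
def twoPoint (γ : ℝ) : EntropyKind → State → State → Block
  | .kinetic => pirozzoli γ
  | .thermo => chandrashekar γ

/-! ### Numerical fluxes -/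

/-- The matrix `R |Λ| S Rᵀ` of the Euler equations in the unit direction `n`, at density `ρ`,
velocity `u` and pressure `p`: `R` has as columns the right eigenvectors of the flux Jacobian, `Λ`
is the diagonal matrix of its eigenvalues `u·n - c`, `u·n` (three times), `u·n + c`, and
`S = diag (ρ/2γ, (γ-1)ρ/γ, p, p, ρ/2γ)` is the scaling for which `R S Rᵀ = ∂q/∂w`. The two shear
eigenvectors enter through the projection `1 - n nᵀ` onto the tangent plane. -/
def roeMatrix (γ ρ p : ℝ) (u n : Fin 3 → ℝ) : Matrix (Fin 5) (Fin 5) ℝ :=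
  let c := √(γ * p / ρ)
  let un := u ⬝ᵥ n
  let h := c ^ 2 / (γ - 1) + (u ⬝ᵥ u) / 2
  let rm := pack 1 (fun i => u i - c * n i) (h - c * un)
  let rp := pack 1 (fun i => u i + c * n i) (h + c * un)
  let r0 := pack 1 u ((u ⬝ᵥ u) / 2)
  let rs : Fin 3 → State := fun i =>
    pack 0 (fun j => (if i = j then 1 else 0) - n i * n j) (u i - n i * un)
  Matrix.of fun a b =>
    |un - c| * (ρ / (2 * γ)) * (rm a * rm b) + |un + c| * (ρ / (2 * γ)) * (rp a * rp b)
      + |un| * ((γ - 1) * ρ / γ * (r0 a * r0 b) + p * ∑ i, rs i a * rs i b)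

/-- The inviscid interface flux: the two-point flux, possibly with a dissipation term (the
Lax–Friedrichs term for the kinetic energy, the matrix dissipation for the thermodynamic entropy).
The matrix is evaluated at the arithmetic mean of the velocities and at averages `ρ̂`, `p̂` of the
densities and pressures. -/
inductive Interface
  | conserving
  | dissipative (rhoHat pHat : State → State → ℝ)

/-- The largest wave speed `|u·n| + c` of the two states. -/
def waveSpeed (γ : ℝ) (n : Fin 3 → ℝ) (q r : State) : ℝ :=
  max (|vel q ⬝ᵥ n| + sound γ q) (|vel r ⬝ᵥ n| + sound γ r)

/-- The dissipation `|λ_max| ⟦Q⟧` or `M ⟦W⟧` in the unit direction `n`. -/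
def dissip (γ : ℝ) : EntropyKind → Interface → (Fin 3 → ℝ) → State → State → State
  | _, .conserving, _, _, _ => 0
  | .kinetic, .dissipative _ _, n, q, r => waveSpeed γ n q r • (r - q)
  | .thermo, .dissipative rhoHat pHat, n, q, r =>
      (roeMatrix γ (rhoHat q r) (pHat q r) (fun i => avg (vel q i) (vel r i)) n).mulVec
        (entVar γ .thermo r - entVar γ .thermo q)

/-- `F · v` for a space vector `v`. -/
def ndot (v : Fin 3 → ℝ) (F : Block) : State := fun a => ∑ d, v d * F d a

def area (v : Fin 3 → ℝ) : ℝ := √(v ⬝ᵥ v)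

def unit (v : Fin 3 → ℝ) : Fin 3 → ℝ := fun i => v i / area v

/-- `F_e^⋆(q, r) · n dS` for the inner state `q`, the outer state `r` and `v = n dS`. -/
def numFlux (γ : ℝ) (k : EntropyKind) (c : Interface) (v : Fin 3 → ℝ) (q r : State) : State :=
  ndot v (twoPoint γ k q r) - (area v / 2) • dissip γ k c (unit v) q r

/-- The ghost state: the normal velocity is reversed. -/
def ghost (n : Fin 3 → ℝ) (q : State) : State :=
  pack (q 0) (fun i => mid q i - 2 * (mid q ⬝ᵥ n) * n i) (q 4)

/-- Adiabatic walls. -/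
inductive Wall
  | freeSlip
  | noSlip

/-- `W^⋆` at a wall. -/
def wallW : Wall → State → State
  | .freeSlip, w => w
  | .noSlip, w => pack (w 0) 0 (w 4)

/-- The viscous or artificial numerical flux `F^⋆ · n dS` at a wall, from the inner `F · n dS`. -/
def wallFlux : Wall → State → State
  | .freeSlip, _ => 0
  | .noSlip, f => pack 0 (mid f) 0

/-! ### Viscous and filtered artificial fluxes -/

/-- Physical constants: heat capacity ratio, gas constant, Prandtl number, molecular viscosity. -/
structure Gas where
  γ : ℝ
  R : ℝ
  Pr : ℝ
  μ : ℝ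

/-- The thermal conductivity `κ = θ μ R`, `θ = γ / ((γ - 1) Pr)`. -/
def Gas.κ (g : Gas) : ℝ := g.γ / ((g.γ - 1) * g.Pr) * g.μ * g.R

/-- `∂ u_i / ∂ x_j` in terms of the gradient `G` of the entropy variables: for the kinetic energy
the velocity is part of `w`; for the thermodynamic entropy `u_i = - w_{i+1} / w_5`. -/
def velGrad (γ : ℝ) : EntropyKind → State → Block → Fin 3 → Fin 3 → ℝ
  | .kinetic, _, G, i, j => mid (G j) i
  | .thermo, q, G, i, j => pres γ q / q 0 * (mid (G j) i + vel q i * G j 4)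

/-- `∂ T / ∂ x_j`: for the thermodynamic entropy `R T = p / ρ = - 1 / w_5`; the kinetic-energy
variables do not contain the temperature, whose gradient `gT` then has to be supplied. -/
def tempGrad (g : Gas) : EntropyKind → State → Block → (Fin 3 → ℝ) → Fin 3 → ℝ
  | .kinetic, _, _, gT, j => gT j
  | .thermo, q, G, _, j => (pres g.γ q / q 0) ^ 2 * G j 4 / g.R

/-- The viscous fluxes: stress tensor, its work, and heat flux. -/
def viscFlux (g : Gas) (k : EntropyKind) (q : State) (G : Block) (gT : Fin 3 → ℝ) : Block :=
  let A := velGrad g.γ k q G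
  let τ : Fin 3 → Fin 3 → ℝ := fun i j =>
    g.μ * (A i j + A j i - if i = j then 2 / 3 * ∑ m, A m m else 0)
  fun d => pack 0 (fun i => τ i d) (∑ i, τ i d * vel q i + g.κ * tempGrad g k q G gT d)

/-- A `15 × 15` block matrix. -/
abbrev BMat := Matrix (Fin 3 × Fin 5) (Fin 3 × Fin 5) ℝ

/-- The coefficients of the artificial viscosity `F_a = B_a G` at one instant, as nodal fields:
* `svv2`: `B_a = α C` with a scalar field `α` and a constant matrix `C`;
* `svv3`: `B_a = Lᵀ D L` with a matrix field `L` and a field `D` of diagonal matrices. -/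
inductive ArtVisc (N : ℕ) (E : Type*)
  | svv2 (α : E → Node N → ℝ) (C : BMat)
  | svv3 (L : E → Node N → BMat) (D : E → Node N → Fin 3 × Fin 5 → ℝ)

/-- Nonnegative viscosity. -/
def ArtVisc.Nonneg {N : ℕ} {E : Type*} : ArtVisc N E → Prop
  | .svv2 α C => (∀ e x, 0 ≤ α e x) ∧ C.PosSemidef
  | .svv3 _ D => ∀ e x k, 0 ≤ D e x k

/-- The filtered artificial flux `√(α/J) C 𝓕⋆(√(J α) G)` or `(1/√J) Lᵀ √D 𝓕⋆(√(J D) L G)` in the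
element `e`, with filter coefficients `K`, Jacobian `J` and gradient `G`. -/
def filtFlux {N : ℕ} {E : Type*} (ξ : Fin (N + 1) → ℝ) (K : Node N → ℝ) (J : Node N → ℝ)
    (G : Node N → Block) (e : E) : ArtVisc N E → Node N → Block
  | .svv2 α C, x => fun d a =>
      √(α e x / J x) *
        ∑ k, C (d, a) k * filt ξ K (fun z => √(J z * α e z) * G z k.1 k.2) x
  | .svv3 L D, x => fun d a =>
      1 / √(J x) * ∑ k, L e x k (d, a) * (√(D e x k) *
        filt ξ K (fun z => √(J z * D e z k) * ∑ l, L e z k l * G z l.1 l.2) x)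

/-- The filtered artificial flux of the scheme. The kinetic-energy variables do not involve the
energy equation, and there the dissipative flux `ea` of the energy is added separately. -/
def artFlux {N : ℕ} {E : Type*} (k : EntropyKind) (ξ : Fin (N + 1) → ℝ) (K : Node N → ℝ)
    (J : Node N → ℝ) (G : Node N → Block) (ea : Node N → Fin 3 → ℝ) (e : E) (A : ArtVisc N E)
    (x : Node N) : Block :=
  match k with
  | .kinetic => fun d => filtFlux ξ K J G e A x d + pack 0 0 (ea x d)
  | .thermo => filtFlux ξ K J G e A x

/-! ### The scheme -/

/-- The fixed data of the discretization. -/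
structure Setup (N : ℕ) (E Fi Fb : Type*) where
  ξ : Fin (N + 1) → ℝ
  mesh : Mesh N ξ E Fi Fb
  gas : Gas
  kind : EntropyKind
  iface : Interface
  wall : Fb → Wall

/-- The data at one instant. -/
structure Snapshot (N : ℕ) (E : Type*) where
  /-- the solution -/
  Q : E → Node N → State
  /-- its time derivative -/
  Qt : E → Node N → State
  /-- the discrete gradient of the entropy variables -/
  G : E → Node N → Block
  /-- coefficients of the artificial viscosity -/
  art : ArtVisc N E
  /-- modal filter coefficients of each element -/
  kernel : E → Node N → ℝ
  /-- discrete gradient of the temperature (used with the kinetic-energy variables only) -/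
  gT : E → Node N → Fin 3 → ℝ
  /-- artificial energy flux (used with the kinetic-energy variables only) -/
  ea : E → Node N → Fin 3 → ℝ

namespace Setup

variable {N : ℕ} {E Fi Fb : Type*} (S : Setup N E Fi Fb) (U : Snapshot N E)

def J (e : E) (x : Node N) : ℝ := jac S.ξ (S.mesh.X e) x

def Ja (e : E) (d n : Fin 3) (x : Node N) : ℝ := contra S.ξ (S.mesh.X e) d n x

/-- The volume node at the point `y` of an element face. -/
def node (f : EFace E) (y : FNode N) : Node N := faceNode f.2.1 f.2.2 y

/-- Outward `n dS` at the point `y` of an element face. -/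
def nv (f : EFace E) (y : FNode N) : Fin 3 → ℝ := nvec S.ξ (S.mesh.X f.1) f.2.1 f.2.2 y

def left (i : Fi) : EFace E := S.mesh.faces (.inl (.inl i))

def right (i : Fi) : EFace E := S.mesh.faces (.inl (.inr i))

def bdry (b : Fb) : EFace E := S.mesh.faces (.inr b)

/-- The point on the right side of an interior face that meets the point `y` of its left side. -/
def orient (i : Fi) : FNode N ≃ FNode N := squareSymm N (S.mesh.perm i) (S.mesh.rev i)

/-- What lies across the point `y` of an element face: a face point of a neighbour, or a wall. -/
def across (f : EFace E) (y : FNode N) : (EFace E × FNode N) ⊕ Fb :=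
  match S.mesh.faces.symm f with
  | .inl (.inl i) => .inl (S.right i, S.orient i y)
  | .inl (.inr i) => .inl (S.left i, (S.orient i).symm y)
  | .inr b => .inr b

def W (e : E) (x : Node N) : State := entVar S.gas.γ S.kind (U.Q e x)

def Fe (e : E) (x : Node N) : Block := eulerFlux S.gas.γ (U.Q e x)

def Fv (e : E) (x : Node N) : Block :=
  viscFlux S.gas S.kind (U.Q e x) (U.G e x) (U.gT e x)

def Fa (e : E) (x : Node N) : Block :=
  artFlux S.kind S.ξ (U.kernel e) (S.J e) (U.G e) (U.ea e) e U.art x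

/-- `W^⋆`: the BR1 average at interior faces, the wall value at walls. -/
def Wstar (f : EFace E) (y : FNode N) : State :=
  match S.across f y with
  | .inl o => fun a => avg (S.W U f.1 (node f y) a) (S.W U o.1.1 (node o.1 o.2) a)
  | .inr b => wallW (S.wall b) (S.W U f.1 (node f y))

/-- `F_e^⋆ · n dS`. -/
def Festar (f : EFace E) (y : FNode N) : State :=
  match S.across f y with
  | .inl o => numFlux S.gas.γ S.kind S.iface (S.nv f y)
      (U.Q f.1 (node f y)) (U.Q o.1.1 (node o.1 o.2))
  | .inr _ => numFlux S.gas.γ S.kind S.iface (S.nv f y)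
      (U.Q f.1 (node f y)) (ghost (unit (S.nv f y)) (U.Q f.1 (node f y)))

/-- `F^⋆ · n dS` for a viscous or artificial flux `F`: the BR1 average at interior faces, the wall
flux at walls. -/
def Fstar (F : E → Node N → Block) (f : EFace E) (y : FNode N) : State :=
  match S.across f y with
  | .inl o => ndot (S.nv f y) fun d a => avg (F f.1 (node f y) d a) (F o.1.1 (node o.1 o.2) d a)
  | .inr b => wallFlux (S.wall b) (ndot (S.nv f y) (F f.1 (node f y)))

/-- The quadrature of a scalar over the reference element. -/
def vol (φ : Node N → ℝ) : ℝ := ∑ x, wt3 S.ξ x * φ x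

/-- The quadrature over a face of a density that already contains `dS`. -/
def surf (φ : FNode N → ℝ) : ℝ := ∑ y, wt2 S.ξ y * φ y

/-- The quadrature over the boundary of the element `e`. -/
def bsurf (e : E) (φ : EFace E → FNode N → ℝ) : ℝ :=
  ∑ d : Fin 3, ∑ s : Bool, S.surf (φ (e, d, s))

/-- Contravariant components `F̃ = Mᵀ F` of a block vector. -/
def tilde (e : E) (F : Node N → Block) (x : Node N) : Block :=
  fun d a => ∑ m, S.Ja e d m x * F x m a

/-- The split-form divergence `𝔻(F^#)`, with arithmetic means of the metric terms. -/
def splitDiv (e : E) (x : Node N) : State := fun a =>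
  2 * ∑ d, ∑ n, dMat S.ξ (x d) n *
    ∑ m, avg (S.Ja e d m x) (S.Ja e d m (Function.update x d n)) *
      twoPoint S.gas.γ S.kind (U.Q e x) (U.Q e (Function.update x d n)) m a

/-- The discrete gradient equation of the element `e`. -/
def GradEq (e : E) : Prop :=
  ∀ φ : Node N → Block,
    S.vol (fun x => S.J e x * ∑ d, U.G e x d ⬝ᵥ φ x d)
      = S.bsurf e (fun f y => S.Wstar U f y ⬝ᵥ ndot (S.nv f y) (φ (node f y)))
        - S.vol (fun x => ∑ a, S.W U e x a * ∑ d, pd S.ξ d (fun z => S.tilde e φ z d a) x)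

/-- The discrete evolution equation of the element `e`. -/
def EvolEq (e : E) : Prop :=
  ∀ φ : Node N → State,
    S.vol (fun x => S.J e x * (U.Qt e x ⬝ᵥ φ x))
        + S.bsurf e (fun f y => φ (node f y) ⬝ᵥ
            (S.Festar U f y - ndot (S.nv f y) (S.Fe U e (node f y))))
        + S.vol (fun x => S.splitDiv U e x ⬝ᵥ φ x)
      = S.bsurf e (fun f y => φ (node f y) ⬝ᵥ
            (S.Fstar (S.Fv U) f y + S.Fstar (S.Fa U) f y))
        - S.vol (fun x => ∑ d, ∑ a,
            S.tilde e (fun z => S.Fv U e z + S.Fa U e z) x d a * pd S.ξ d (fun z => φ z a) x)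

/-! ### The terms of the entropy balance -/

/-- The total discrete entropy `∑_e ⟨J 𝓔⟩`. -/
def totalEntropy [Fintype E] (Q : E → Node N → State) : ℝ :=
  ∑ e, S.vol fun x => S.J e x * entropy S.gas.γ S.kind (Q e x)

/-- The volume dissipation `⟨J G, F⟩` of a flux `F` in the element `e`. -/
def volDiss (F : E → Node N → Block) (e : E) : ℝ :=
  S.vol fun x => S.J e x * ∑ d, U.G e x d ⬝ᵥ F e x d

/-- The discrete work of the pressure in the element `e`: the velocity tested against the pressure
part of the split-form divergence. -/
def presWork (e : E) : ℝ :=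
  S.vol fun x => ∑ m, vel (U.Q e x) m *
    (2 * ∑ d, ∑ n, dMat S.ξ (x d) n *
      (avg (S.Ja e d m x) (S.Ja e d m (Function.update x d n)) *
        avg (pres S.gas.γ (U.Q e x)) (pres S.gas.γ (U.Q e (Function.update x d n)))))

/-- State at the left and right side of the point `y` of an interior face. -/
def QL (i : Fi) (y : FNode N) : State := U.Q (S.left i).1 (node (S.left i) y)

def QR (i : Fi) (y : FNode N) : State := U.Q (S.right i).1 (node (S.right i) (S.orient i y))

def WL (i : Fi) (y : FNode N) : State := entVar S.gas.γ S.kind (S.QL U i y)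

def WR (i : Fi) (y : FNode N) : State := entVar S.gas.γ S.kind (S.QR U i y)

/-- The work of the pressure jumps at the interior faces, `∑_f ∫ {{u}} · n_L ⟦p⟧ dS`. -/
def presWorkFaces [Fintype Fi] : ℝ :=
  ∑ i, S.surf fun y =>
    (∑ m, avg (vel (S.QL U i y) m) (vel (S.QR U i y) m) * S.nv (S.left i) y m) *
      (pres S.gas.γ (S.QR U i y) - pres S.gas.γ (S.QL U i y))

/-- The inviscid interior boundary terms,
`- ∑_f ∫ (⟦F^𝓔⟧ + ⟦W⟧ᵀ F_e^⋆ - ⟦Wᵀ F_e⟧) · n_L dS`. -/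
def ibtE [Fintype Fi] : ℝ :=
  -∑ i, S.surf fun y =>
    (entFlux S.gas.γ S.kind (S.QR U i y) - entFlux S.gas.γ S.kind (S.QL U i y))
        ⬝ᵥ S.nv (S.left i) y
      + (S.WR U i y - S.WL U i y) ⬝ᵥ S.Festar U (S.left i) y
      - (S.WR U i y ⬝ᵥ ndot (S.nv (S.left i) y) (eulerFlux S.gas.γ (S.QR U i y))
        - S.WL U i y ⬝ᵥ ndot (S.nv (S.left i) y) (eulerFlux S.gas.γ (S.QL U i y)))

/-- The interior boundary terms of a viscous or artificial flux `F`,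
`∑_f ∫ (⟦W⟧ᵀ F^⋆ + W^⋆ᵀ ⟦F⟧ - ⟦Wᵀ F⟧) · n_L dS`. -/
def ibt [Fintype Fi] (F : E → Node N → Block) : ℝ :=
  ∑ i, S.surf fun y =>
    let fL := ndot (S.nv (S.left i) y) (F (S.left i).1 (node (S.left i) y))
    let fR := ndot (S.nv (S.left i) y) (F (S.right i).1 (node (S.right i) (S.orient i y)))
    (S.WR U i y - S.WL U i y) ⬝ᵥ S.Fstar F (S.left i) y + S.Wstar U (S.left i) y ⬝ᵥ (fR - fL)
      - (S.WR U i y ⬝ᵥ fR - S.WL U i y ⬝ᵥ fL)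

/-- The inviscid physical boundary terms, `∑_f ∫ (F^𝓔 + Wᵀ F_e^⋆ - Wᵀ F_e) · n dS`. -/
def pbtE [Fintype Fb] : ℝ :=
  ∑ b, S.surf fun y =>
    let f := S.bdry b
    entFlux S.gas.γ S.kind (U.Q f.1 (node f y)) ⬝ᵥ S.nv f y
      + S.W U f.1 (node f y) ⬝ᵥ S.Festar U f y
      - S.W U f.1 (node f y) ⬝ᵥ ndot (S.nv f y) (S.Fe U f.1 (node f y))

/-- The physical boundary terms of a viscous or artificial flux `F`,
`- ∑_f ∫ (Wᵀ F^⋆ + W^⋆ᵀ F - Wᵀ F) · n dS`. -/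
def pbt [Fintype Fb] (F : E → Node N → Block) : ℝ :=
  -∑ b, S.surf fun y =>
    let f := S.bdry b
    S.W U f.1 (node f y) ⬝ᵥ S.Fstar F f y
      + S.Wstar U f y ⬝ᵥ ndot (S.nv f y) (F f.1 (node f y))
      - S.W U f.1 (node f y) ⬝ᵥ ndot (S.nv f y) (F f.1 (node f y))

/-- `U t`, `t ∈ T`, is a solution of the semi-discrete scheme on the time interval `T`, with
positive density and pressure at the nodes. -/
structure IsSolution (T : Set ℝ) (U : ℝ → Snapshot N E) : Prop where
  deriv : ∀ t ∈ T, ∀ e x a, HasDerivWithinAt (fun s => (U s).Q e x a) ((U t).Qt e x a) T t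
  grad : ∀ t ∈ T, ∀ e, S.GradEq (U t) e
  evol : ∀ t ∈ T, ∀ e, S.EvolEq (U t) e
  admissible : ∀ t ∈ T, ∀ e x, Admissible S.gas.γ ((U t).Q e x)

end Setup

/-- The averages `ρ̂`, `p̂` in the matrix dissipation are symmetric, and positive for admissible
states. -/
def Interface.Proper (γ : ℝ) : Interface → Prop
  | .conserving => True
  | .dissipative rhoHat pHat =>
      (∀ q r, rhoHat q r = rhoHat r q ∧ pHat q r = pHat r q) ∧
        ∀ q r, Admissible γ q → Admissible γ r → 0 < rhoHat q r ∧ 0 < pHat q r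

end DGSEM

end

/-! The continuous argument multiplies the equations by the entropy variables $W$ and integrates by
parts. Here it is repeated at the nodes, where the chain rule holds only in time, and each spatial
step has an exact discrete substitute.

Integration by parts becomes `sbp`: the Gauss–Lobatto rule integrates $(l_il_j)'$ exactly, since
that polynomial has degree at most $2N-1$. Applied to two-point functions on the cube (`sbp_cube`),
it shows that the part of $W^TF^\#$ symmetric in the two nodes contributes only at the faces.

For the thermodynamic entropy the remaining antisymmetric part is a difference of the potential
$\rho\vec u$ (`chandrashekar_conserving`). It telescopes up to the discrete divergence of the metric
terms, which vanishes because they are a discrete curl (`metric_identity`). For the kinetic energy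
the remainder is the work of the pressure. Both cases are combined in `splitDiv_balance`.

Testing the evolution equation with $W$ and the gradient equation with $F_v+F_a$ then gives
`element_balance`. In the sum over elements the face terms pair up. The BR1 terms cancel by the
product rule for jumps (`avg_jump`). The inviscid ones reduce to numerical dissipation and the work
of pressure jumps (`inviscid_jump`), and the walls are settled by `numFlux_ghost` and
`wall_balance`.

What is left has a sign. The matrix dissipation and the viscous flux give weighted sums of squares.
The filter is diagonal with nonnegative entries in Legendre space, and distributing $\sqrt{\mathcal
J}$ on both sides of it makes the artificial dissipation a nonnegative quadratic form
(`filtFlux_dissipative`). -/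

namespace DGSEM

/-! ### One-dimensional summation by parts and positivity of the quadrature weights. -/

section OneDim

variable {N : ℕ} {ξ : Fin (N + 1) → ℝ}

theorem IsGaussLobatto.pos (h : IsGaussLobatto ξ) : 0 < N := by
  rcases Nat.eq_zero_or_pos N with h0 | h0
  · subst h0
    have h1 := h.2.1
    have h2 := h.2.2.1
    have : (Fin.last 0) = 0 := rfl
    rw [this, h1] at h2
    norm_num at h2
  · exact h0

theorem eval_lagr (h : IsGaussLobatto ξ) (i j : Fin (N + 1)) :
    (lagr ξ i).eval (ξ j) = if i = j then 1 else 0 := by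
  split_ifs with hij
  · subst hij
    exact Lagrange.eval_basis_self (h.1.injective.injOn) (Finset.mem_univ _)
  · exact Lagrange.eval_basis_of_ne hij (Finset.mem_univ _)

theorem natDegree_lagr (h : IsGaussLobatto ξ) (i : Fin (N + 1)) : (lagr ξ i).natDegree = N := by
  have := Lagrange.natDegree_basis (s := Finset.univ) (v := ξ) h.1.injective.injOn
    (Finset.mem_univ i)
  simpa [lagr] using this

theorem integral_derivative_eval (f : ℝ[X]) :
    ∫ x in (-1 : ℝ)..1, (derivative f).eval x = f.eval 1 - f.eval (-1) := by
  exact intervalIntegral.integral_eq_sub_of_hasDerivAt (f := fun x => f.eval x)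
    (fun x _ => f.hasDerivAt x) ((derivative f).continuous.intervalIntegrable _ _)

/-- The summation-by-parts property of the derivative matrix. -/
theorem sbp (h : IsGaussLobatto ξ) (i j : Fin (N + 1)) :
    wt ξ i * dMat ξ i j + wt ξ j * dMat ξ j i
      = (if i = Fin.last N ∧ j = Fin.last N then 1 else 0) - (if i = 0 ∧ j = 0 then 1 else 0) := by
  have hN := h.pos
  -- The product has degree $2N$ and its derivative at most $2N-1$, the last degree that the
  -- quadrature integrates exactly.
  have hdeg : (derivative (lagr ξ i * lagr ξ j)).natDegree < 2 * N := by
    have h1 := natDegree_derivative_le (lagr ξ i * lagr ξ j)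
    have h2 := natDegree_mul_le (p := lagr ξ i) (q := lagr ξ j)
    rw [natDegree_lagr h, natDegree_lagr h] at h2
    omega
  have hex := h.2.2.2 _ hdeg
  rw [integral_derivative_eval] at hex
  have e1 : ∀ k, (lagr ξ k).eval 1 = if k = Fin.last N then 1 else 0 := fun k => by
    simpa only [h.2.2.1] using eval_lagr h k (Fin.last N)
  have e2 : ∀ k, (lagr ξ k).eval (-1) = if k = 0 then 1 else 0 := fun k => by
    simpa only [h.2.1] using eval_lagr h k 0
  simp only [eval_mul, e1, e2, derivative_mul, eval_add, eval_lagr h, mul_add,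
    Finset.sum_add_distrib, mul_ite, mul_one, mul_zero, ite_mul, one_mul, zero_mul,
    Finset.sum_ite_eq, Finset.mem_univ, if_true] at hex
  simp only [and_comm (a := i = Fin.last N), and_comm (a := i = 0)]
  simp only [ite_and, dMat]
  rw [add_comm]
  exact hex.symm

theorem sum_dMat (h : IsGaussLobatto ξ) (i : Fin (N + 1)) : ∑ j, dMat ξ i j = 0 := by
  have h1 : ∑ j, lagr ξ j = 1 :=
    Lagrange.sum_basis h.1.injective.injOn Finset.univ_nonempty
  have h2 := congrArg (fun f => (derivative f).eval (ξ i)) h1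
  simpa [derivative_sum, eval_finsetSum, dMat] using h2

/-- The exact quadrature of `f` sees only the node `i`, so its positive integral equals `wt ξ i *
f.eval (ξ i)` and the weight inherits the sign. -/
theorem weight_pos_of_test (h : IsGaussLobatto ξ) (i : Fin (N + 1)) (f : ℝ[X])
    (hdeg : f.natDegree < 2 * N) (hnn : ∀ x ∈ Set.Icc (-1 : ℝ) 1, 0 ≤ f.eval x)
    (hz : ∀ j, j ≠ i → f.eval (ξ j) = 0) (hi : f.eval (ξ i) ≠ 0) : 0 < wt ξ i := by
  have hmem : ξ i ∈ Set.Icc (-1 : ℝ) 1 := by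
    rw [← h.2.1, ← h.2.2.1]
    exact ⟨h.1.monotone (Fin.zero_le _), h.1.monotone (Fin.le_last _)⟩
  have hpos : 0 < f.eval (ξ i) := lt_of_le_of_ne (hnn _ hmem) hi.symm
  have hint : 0 < ∫ x in (-1 : ℝ)..1, f.eval x := by
    apply intervalIntegral.integral_pos (by norm_num) f.continuous.continuousOn
    · intro x hx
      exact hnn x ⟨hx.1.le, hx.2⟩
    · exact ⟨ξ i, hmem, hpos⟩
  rw [h.2.2.2 f hdeg, Finset.sum_eq_single i (fun j _ hj => by rw [hz j hj, mul_zero])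
    (fun hn => absurd (Finset.mem_univ i) hn)] at hint
  exact pos_of_mul_pos_left hint hpos.le

/-- The Gauss–Lobatto weights are positive. -/
theorem wt_pos (h : IsGaussLobatto ξ) (i : Fin (N + 1)) : 0 < wt ξ i := by
  classical
  have hN := h.pos
  have h0N : (0 : Fin (N + 1)) ≠ Fin.last N := by
    intro hh
    have := congrArg Fin.val hh
    simp at this
    omega
  set I : Finset (Fin (N + 1)) := (Finset.univ.erase 0).erase (Fin.last N) with hI
  have hIcard : I.card = N - 1 := by
    rw [hI, Finset.card_erase_of_mem (by simp [h0N.symm]), Finset.card_erase_of_mem (by simp)]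
    simp
  set g : ℝ[X] := ∏ j ∈ I.erase i, (X - C (ξ j)) with hg
  have hgdeg : g.natDegree = (I.erase i).card := by
    rw [hg, natDegree_prod_of_monic _ _ (fun j _ => monic_X_sub_C _)]
    simp
  have hge : ∀ x, g.eval x = ∏ j ∈ I.erase i, (x - ξ j) := fun x => by
    simp [hg, eval_prod]
  have hgz : ∀ j ∈ I.erase i, g.eval (ξ j) = 0 := fun j hj => by
    rw [hge]
    exact Finset.prod_eq_zero hj (sub_self _)
  have hgi : g.eval (ξ i) ≠ 0 := by
    rw [hge]
    refine Finset.prod_ne_zero_iff.2 fun j hj => sub_ne_zero.2 ?_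
    exact fun hh => (Finset.ne_of_mem_erase hj) (h.1.injective hh).symm
  -- The test polynomial is $(1+x)(1-x)g^2$, without the linear factor that vanishes at $\xi_i$ when
  -- $i$ is an end point. Its degree is at most $2N-2$ for interior $i$ and $2N-1$ for an end point.
  set a : ℝ[X] := if i = 0 then 1 else X + 1 with ha
  set b : ℝ[X] := if i = Fin.last N then 1 else 1 - X with hb
  have hX1 : (X + 1 : ℝ[X]).natDegree ≤ 1 := by
    simpa using (natDegree_X_add_C (1 : ℝ)).le
  have hX2 : (1 - X : ℝ[X]).natDegree ≤ 1 := by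
    refine (natDegree_sub_le _ _).trans ?_
    simp
  refine weight_pos_of_test h i (a * b * g ^ 2) ?_ ?_ ?_ ?_
  · have h1 := natDegree_mul_le (p := a * b) (q := g ^ 2)
    have h2 := natDegree_mul_le (p := a) (q := b)
    have h3 : (g ^ 2).natDegree ≤ 2 * g.natDegree := natDegree_pow_le
    by_cases hi0 : i = 0
    · have ha0 : a.natDegree = 0 := by simp [ha, hi0]
      have hb0 : b.natDegree ≤ 1 := by
        rw [hb]; split_ifs
        · simp
        · exact hX2
      have : (I.erase i).card ≤ N - 1 := hIcard ▸ Finset.card_erase_le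
      omega
    · by_cases hiN : i = Fin.last N
      · have hb0 : b.natDegree = 0 := by simp [hb, hiN]
        have ha0 : a.natDegree ≤ 1 := by
          rw [ha, if_neg hi0]; exact hX1
        have : (I.erase i).card ≤ N - 1 := hIcard ▸ Finset.card_erase_le
        omega
      · have ha0 : a.natDegree ≤ 1 := by
          rw [ha, if_neg hi0]; exact hX1
        have hb0 : b.natDegree ≤ 1 := by
          rw [hb, if_neg hiN]; exact hX2
        have hiI : i ∈ I := by simp [hI, hi0, hiN]
        have h5 := Finset.card_pos.2 ⟨i, hiI⟩
        have : (I.erase i).card = N - 1 - 1 := by rw [Finset.card_erase_of_mem hiI, hIcard]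
        omega
  · intro x hx
    have ha1 : 0 ≤ a.eval x := by
      rw [ha]; split_ifs
      · simp
      · simp; linarith [hx.1]
    have hb1 : 0 ≤ b.eval x := by
      rw [hb]; split_ifs
      · simp
      · simp; linarith [hx.2]
    simp only [eval_mul, eval_pow]
    positivity
  · intro j hj
    simp only [eval_mul, eval_pow]
    by_cases hj0 : j = 0
    · have : a.eval (ξ j) = 0 := by
        rw [ha, if_neg (by rintro rfl; exact hj hj0), hj0, h.2.1]; simp
      simp [this]
    · by_cases hjN : j = Fin.last N
      · have : b.eval (ξ j) = 0 := by
          rw [hb, if_neg (by rintro rfl; exact hj hjN), hjN, h.2.2.1]; simp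
        simp [this]
      · rw [hgz j (by simp [hI, hj, hj0, hjN])]; simp
  · simp only [eval_mul, eval_pow]
    refine mul_ne_zero (mul_ne_zero ?_ ?_) (pow_ne_zero _ hgi)
    · rw [ha]; split_ifs with hi0
      · simp
      · have : ξ 0 < ξ i := h.1 (Fin.pos_of_ne_zero hi0)
        rw [h.2.1] at this
        simp; linarith
    · rw [hb]; split_ifs with hi0
      · simp
      · have : ξ i < ξ (Fin.last N) := h.1 (Fin.lt_last_iff_ne_last.2 hi0)
        rw [h.2.2.1] at this
        simp; linarith

/-- Summation by parts for a two-point function. -/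
theorem sbp_twoPoint (h : IsGaussLobatto ξ) (T : Fin (N + 1) → Fin (N + 1) → ℝ) :
    ∑ i, ∑ n, wt ξ i * dMat ξ i n * (T i n + T n i)
      = T (Fin.last N) (Fin.last N) - T 0 0 := by
  -- Swapping the summation indices moves the transposition from `T` to the matrix, so `sbp` applies
  -- entry by entry.
  have h1 : ∑ i, ∑ n, wt ξ i * dMat ξ i n * T n i
      = ∑ i, ∑ n, wt ξ n * dMat ξ n i * T i n := Finset.sum_comm
  simp only [mul_add, Finset.sum_add_distrib]
  rw [h1]
  simp only [← Finset.sum_add_distrib, ← add_mul, sbp h]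
  simp [sub_mul, ite_and, Finset.sum_sub_distrib]

end OneDim

/-! ### Summation by parts on the cube and the metric identities. -/

section Cube

variable {N : ℕ} {ξ : Fin (N + 1) → ℝ}

theorem wt3_pos (h : IsGaussLobatto ξ) (x : Node N) : 0 < wt3 ξ x :=
  Finset.prod_pos fun _ _ => wt_pos h _

theorem wt2_pos (h : IsGaussLobatto ξ) (y : FNode N) : 0 < wt2 ξ y :=
  Finset.prod_pos fun _ _ => wt_pos h _

theorem wt3_insertNth (d : Fin 3) (i : Fin (N + 1)) (y : FNode N) :
    wt3 ξ (Fin.insertNth (α := fun _ => Fin (N + 1)) d i y) = wt ξ i * wt2 ξ y := by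
  simp [wt3, wt2, Fin.prod_univ_succAbove _ d]

theorem sum_node (d : Fin 3) (f : Node N → ℝ) :
    ∑ x, f x = ∑ y : FNode N, ∑ i, f (Fin.insertNth (α := fun _ => Fin (N + 1)) d i y) := by
  rw [← (Fin.insertNthEquiv (fun _ => Fin (N + 1)) d).sum_comp, Fintype.sum_prod_type,
    Finset.sum_comm]
  rfl

/-- Summation by parts in the direction `d` for a two-point function on the cube. -/
theorem sbp_cube (h : IsGaussLobatto ξ) (d : Fin 3) (T : Node N → Node N → ℝ) :
    ∑ x, wt3 ξ x * ∑ n, dMat ξ (x d) n *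
        (T x (Function.update x d n) + T (Function.update x d n) x)
      = ∑ y, wt2 ξ y * (T (faceNode d true y) (faceNode d true y)
          - T (faceNode d false y) (faceNode d false y)) := by
  rw [sum_node d]
  refine Finset.sum_congr rfl fun y _ => ?_
  have := sbp_twoPoint h fun i n => T (Fin.insertNth (α := fun _ => Fin (N + 1)) d i y)
    (Fin.insertNth (α := fun _ => Fin (N + 1)) d n y)
  simp only [faceNode, if_true, Bool.false_eq_true, if_false]
  rw [← this, Finset.mul_sum]
  refine Finset.sum_congr rfl fun i _ => ?_
  rw [wt3_insertNth, Finset.mul_sum, Finset.mul_sum]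
  refine Finset.sum_congr rfl fun n _ => ?_
  simp only [Fin.insertNth_apply_same, Fin.update_insertNth]
  ring

/-- The discrete product rule. -/
theorem sbp_mul (h : IsGaussLobatto ξ) (d : Fin 3) (f g : Node N → ℝ) :
    ∑ x, wt3 ξ x * (f x * pd ξ d g x) + ∑ x, wt3 ξ x * (g x * pd ξ d f x)
      = ∑ y, wt2 ξ y * (f (faceNode d true y) * g (faceNode d true y)
          - f (faceNode d false y) * g (faceNode d false y)) := by
  rw [← sbp_cube h d fun x z => f x * g z, ← Finset.sum_add_distrib]
  refine Finset.sum_congr rfl fun x _ => ?_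
  simp only [pd, ← mul_add, Finset.mul_sum, ← Finset.sum_add_distrib]
  refine Finset.sum_congr rfl fun n _ => ?_
  ring

theorem sum_dMat_mul (h : IsGaussLobatto ξ) (i : Fin (N + 1)) (c : ℝ) :
    ∑ n, dMat ξ i n * c = 0 := by
  rw [← Finset.sum_mul, sum_dMat h, zero_mul]

/-- Flux differencing of a skew difference with arithmetic means of the metric terms. -/
theorem sbp_avg_sub (h : IsGaussLobatto ξ) (d : Fin 3) (a ψ : Node N → ℝ) :
    ∑ x, wt3 ξ x * ∑ n, dMat ξ (x d) n *
        (avg (a x) (a (Function.update x d n)) * (ψ x - ψ (Function.update x d n)))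
      = -∑ y, wt2 ξ y * (a (faceNode d true y) * ψ (faceNode d true y)
          - a (faceNode d false y) * ψ (faceNode d false y))
        + ∑ x, wt3 ξ x * (ψ x * pd ξ d a x) := by
  have h1 := sbp_cube h d fun x z => a x * ψ z
  have h2 := sbp_cube h d fun _ z => a z * ψ z
  -- The skew product is completed to symmetric two-point sums, which `sbp_cube` turns into face
  -- terms. The extra diagonal term vanishes because the rows of the derivative matrix sum to zero.
  have h3 : ∑ x, wt3 ξ x * ∑ n, dMat ξ (x d) n *
        (avg (a x) (a (Function.update x d n)) * (ψ x - ψ (Function.update x d n)))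
      = (∑ x, wt3 ξ x * ∑ n, dMat ξ (x d) n * (a x * ψ x))
        - 1 / 2 * (∑ x, wt3 ξ x * ∑ n, dMat ξ (x d) n *
            (a x * ψ (Function.update x d n) + a (Function.update x d n) * ψ x))
        - 1 / 2 * (∑ x, wt3 ξ x * ∑ n, dMat ξ (x d) n *
            (a (Function.update x d n) * ψ (Function.update x d n) + a x * ψ x))
        + ∑ x, wt3 ξ x * (ψ x * pd ξ d a x) := by
    simp only [pd, Finset.mul_sum, ← Finset.sum_sub_distrib, ← Finset.sum_add_distrib]
    refine Finset.sum_congr rfl fun x _ => Finset.sum_congr rfl fun n _ => ?_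
    simp only [avg]
    ring
  rw [h3, h1, h2]
  simp only [sum_dMat_mul h]
  simp
  ring

theorem pd_sub (d : Fin 3) (f g : Node N → ℝ) (x : Node N) :
    pd ξ d (fun z => f z - g z) x = pd ξ d f x - pd ξ d g x := by
  simp [pd, mul_sub, Finset.sum_sub_distrib]

theorem pd_neg (d : Fin 3) (f : Node N → ℝ) (x : Node N) :
    pd ξ d (fun z => -f z) x = -pd ξ d f x := by
  simp [pd]

theorem pd_comm {d d' : Fin 3} (hd : d ≠ d') (f : Node N → ℝ) (x : Node N) :
    pd ξ d (pd ξ d' f) x = pd ξ d' (pd ξ d f) x := by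
  simp only [pd, Finset.mul_sum, Function.update_of_ne hd, Function.update_of_ne hd.symm]
  rw [Finset.sum_comm]
  refine Finset.sum_congr rfl fun n _ => Finset.sum_congr rfl fun m _ => ?_
  rw [Function.update_comm hd]
  ring

/-- The discrete metric identities. -/
theorem metric_identity (X : Node N → Fin 3 → ℝ) (n : Fin 3) (x : Node N) :
    ∑ i, pd ξ i (contra ξ X i n) x = 0 := by
  have key : ∀ i, pd ξ i (contra ξ X i n) x
      = -(pd ξ i (pd ξ (i + 1) fun z => X z (n + 2) * pd ξ (i + 2) (fun z' => X z' (n + 1)) z) x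
        - pd ξ i (pd ξ (i + 2) fun z => X z (n + 2) * pd ξ (i + 1) (fun z' => X z' (n + 1)) z) x) :=
    fun i => by
      unfold contra
      rw [pd_neg, pd_sub]
  simp only [key, Fin.sum_univ_three]
  have e1 : (0 : Fin 3) + 1 = 1 := rfl
  have e2 : (0 : Fin 3) + 2 = 2 := rfl
  have e3 : (1 : Fin 3) + 1 = 2 := rfl
  have e4 : (1 : Fin 3) + 2 = 0 := rfl
  have e5 : (2 : Fin 3) + 1 = 0 := rfl
  have e6 : (2 : Fin 3) + 2 = 1 := rfl
  simp only [e1, e2, e3, e4, e5, e6]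
  -- The divergence of a curl vanishes because nodal derivatives in different directions commute
  -- exactly.
  rw [pd_comm (d := 1) (d' := 0) (by decide), pd_comm (d := 2) (d' := 0) (by decide),
    pd_comm (d := 2) (d' := 1) (by decide)]
  ring

end Cube

end DGSEM

namespace DGSEM

/-! ### Uniqueness of the Gauss–Lobatto nodes and, from it, symmetry of the weights. -/

section Uniqueness

variable {N : ℕ} {ξ η : Fin (N + 1) → ℝ}

/-- The indices of the interior nodes. -/
def interiorIdx (N : ℕ) : Finset (Fin (N + 1)) := (Finset.univ.erase 0).erase (Fin.last N)

theorem mem_interiorIdx {i : Fin (N + 1)} : i ∈ interiorIdx N ↔ i ≠ Fin.last N ∧ i ≠ 0 := by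
  simp [interiorIdx]

theorem card_interiorIdx (hN : 0 < N) : (interiorIdx N).card = N - 1 := by
  have h0N : (0 : Fin (N + 1)) ≠ Fin.last N := by
    intro hh
    have := congrArg Fin.val hh
    simp at this
    omega
  rw [interiorIdx, Finset.card_erase_of_mem (by simp [h0N.symm]),
    Finset.card_erase_of_mem (by simp)]
  simp

/-- The monic polynomial vanishing at the interior nodes. -/
noncomputable def interiorPoly (ξ : Fin (N + 1) → ℝ) : ℝ[X] :=
  ∏ j ∈ interiorIdx N, (X - C (ξ j))

theorem interiorPoly_monic (ξ : Fin (N + 1) → ℝ) : (interiorPoly ξ).Monic :=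
  monic_prod_of_monic _ _ fun _ _ => monic_X_sub_C _

theorem natDegree_interiorPoly (hN : 0 < N) (ξ : Fin (N + 1) → ℝ) :
    (interiorPoly ξ).natDegree = N - 1 := by
  rw [interiorPoly, natDegree_prod_of_monic _ _ (fun j _ => monic_X_sub_C _)]
  simp [card_interiorIdx hN]

theorem eval_interiorPoly_eq_zero {x : ℝ} :
    (interiorPoly ξ).eval x = 0 ↔ ∃ j ∈ interiorIdx N, x = ξ j := by
  simp [interiorPoly, eval_prod, Finset.prod_eq_zero_iff, sub_eq_zero]

theorem natDegree_one_sub_X_sq : (1 - X ^ 2 : ℝ[X]).natDegree ≤ 2 :=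
  (natDegree_sub_le _ _).trans (by simp)

/-- Orthogonality of the interior polynomial. -/
theorem integral_interiorPoly_mul (h : IsGaussLobatto ξ) {g : ℝ[X]}
    (hg : g.natDegree < N - 1) :
    ∫ x in (-1 : ℝ)..1, ((1 - X ^ 2) * interiorPoly ξ * g).eval x = 0 := by
  have hN := h.pos
  -- The integrand has degree below $2+(N-1)+(N-1)=2N$, and it vanishes at every node: at the end
  -- points through $1-x^2$, inside through the interior polynomial.
  rw [h.2.2.2]
  · refine Finset.sum_eq_zero fun i _ => ?_
    simp only [eval_mul, eval_sub, eval_one, eval_pow, eval_X]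
    by_cases hi : i ∈ interiorIdx N
    · rw [eval_interiorPoly_eq_zero.2 ⟨i, hi, rfl⟩]; ring
    · have : i = Fin.last N ∨ i = 0 := by
        rw [mem_interiorIdx] at hi; tauto
      rcases this with rfl | rfl
      · rw [h.2.2.1]; ring
      · rw [h.2.1]; ring
  · have h1 := natDegree_mul_le (p := (1 - X ^ 2) * interiorPoly ξ) (q := g)
    have h2 := natDegree_mul_le (p := (1 - X ^ 2 : ℝ[X])) (q := interiorPoly ξ)
    have h3 := natDegree_one_sub_X_sq
    rw [natDegree_interiorPoly hN] at h2
    omega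

/-- The difference of the two monic polynomials has degree below $N-1$, so both are orthogonal to it
for the weight $1-x^2$. It is thus orthogonal to itself and must vanish. -/
theorem interiorPoly_unique (h : IsGaussLobatto ξ) (h' : IsGaussLobatto η) :
    interiorPoly ξ = interiorPoly η := by
  have hN := h.pos
  by_contra hne
  set g := interiorPoly ξ - interiorPoly η with hgdef
  have hg0 : g ≠ 0 := sub_ne_zero.2 hne
  have hdeg : g.natDegree < N - 1 := by
    rw [← natDegree_interiorPoly hN ξ]
    refine natDegree_lt_natDegree hg0 (degree_sub_lt_left ?_ (interiorPoly_monic ξ).ne_zero ?_)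
    · rw [degree_eq_natDegree (interiorPoly_monic ξ).ne_zero,
        degree_eq_natDegree (interiorPoly_monic η).ne_zero, natDegree_interiorPoly hN,
        natDegree_interiorPoly hN]
    · rw [(interiorPoly_monic ξ).leadingCoeff, (interiorPoly_monic η).leadingCoeff]
  have hint : ∫ x in (-1 : ℝ)..1, ((1 - X ^ 2) * g * g).eval x = 0 := by
    have e : (1 - X ^ 2) * g * g
        = (1 - X ^ 2) * interiorPoly ξ * g - (1 - X ^ 2) * interiorPoly η * g := by
      rw [hgdef]; ring
    simp only [e, eval_sub]
    rw [intervalIntegral.integral_sub ((Polynomial.continuous _).intervalIntegrable _ _)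
      ((Polynomial.continuous _).intervalIntegrable _ _), integral_interiorPoly_mul h hdeg,
      integral_interiorPoly_mul h' hdeg, sub_zero]
  rw [h.2.2.2] at hint
  · have hmem : ∀ i, ξ i ∈ Set.Icc (-1 : ℝ) 1 := fun i => by
      rw [← h.2.1, ← h.2.2.1]
      exact ⟨h.1.monotone (Fin.zero_le _), h.1.monotone (Fin.le_last _)⟩
    have hnn : ∀ i ∈ Finset.univ, 0 ≤ wt ξ i * ((1 - X ^ 2) * g * g).eval (ξ i) := by
      intro i _
      refine mul_nonneg (wt_pos h i).le ?_
      simp only [eval_mul, eval_sub, eval_one, eval_pow, eval_X, mul_assoc]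
      refine mul_nonneg ?_ (mul_self_nonneg _)
      nlinarith [(hmem i).1, (hmem i).2]
    have hz := (Finset.sum_eq_zero_iff_of_nonneg hnn).1 hint
    -- All terms of the vanishing quadrature are nonnegative, so `g` is zero at the $N-1$ interior
    -- nodes, more points than its degree allows.
    refine hg0 (eq_zero_of_natDegree_lt_card_of_eval_eq_zero' g ((interiorIdx N).image ξ) ?_ ?_)
    · intro x hx
      obtain ⟨i, hi, rfl⟩ := Finset.mem_image.1 hx
      rw [mem_interiorIdx] at hi
      have h1 := hz i (Finset.mem_univ i)
      simp only [eval_mul, eval_sub, eval_one, eval_pow, eval_X] at h1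
      have ha : ξ 0 < ξ i := h.1 (Fin.pos_of_ne_zero hi.2)
      have hb : ξ i < ξ (Fin.last N) := h.1 (Fin.lt_last_iff_ne_last.2 hi.1)
      rw [h.2.1] at ha
      rw [h.2.2.1] at hb
      have hc : 1 - ξ i ^ 2 ≠ 0 := by
        have : 0 < 1 - ξ i ^ 2 := by nlinarith
        exact this.ne'
      rcases mul_eq_zero.1 h1 with h2 | h2
      · exact absurd h2 (wt_pos h i).ne'
      · rcases mul_eq_zero.1 h2 with h3 | h3
        · exact (mul_eq_zero.1 h3).resolve_left hc
        · exact h3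
    · rw [Finset.card_image_of_injective _ h.1.injective, card_interiorIdx hN]
      exact hdeg
  · have h1 := natDegree_mul_le (p := (1 - X ^ 2) * g) (q := g)
    have h2 := natDegree_mul_le (p := (1 - X ^ 2 : ℝ[X])) (q := g)
    have h3 := natDegree_one_sub_X_sq
    omega

theorem range_subset_of_isGaussLobatto (h : IsGaussLobatto ξ) (h' : IsGaussLobatto η) :
    Set.range ξ ⊆ Set.range η := by
  rintro _ ⟨i, rfl⟩
  by_cases hi : i ∈ interiorIdx N
  · have h1 := (eval_interiorPoly_eq_zero (ξ := ξ) (x := ξ i)).2 ⟨i, hi, rfl⟩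
    rw [interiorPoly_unique h h'] at h1
    obtain ⟨j, _, hj⟩ := eval_interiorPoly_eq_zero.1 h1
    exact ⟨j, hj.symm⟩
  · have : i = Fin.last N ∨ i = 0 := by
      rw [mem_interiorIdx] at hi; tauto
    rcases this with rfl | rfl
    · exact ⟨Fin.last N, by rw [h.2.2.1, h'.2.2.1]⟩
    · exact ⟨0, by rw [h.2.1, h'.2.1]⟩

/-- The Gauss–Lobatto nodes are unique. -/
theorem IsGaussLobatto.unique (h : IsGaussLobatto ξ) (h' : IsGaussLobatto η) : ξ = η :=
  (StrictMono.range_inj h.1 h'.1).1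
    ((range_subset_of_isGaussLobatto h h').antisymm (range_subset_of_isGaussLobatto h' h))

/-- Symmetry of the nodes is not part of `IsGaussLobatto`. It follows from uniqueness once the
reflected nodes are seen to form a Gauss–Lobatto family, which starts from this behaviour of the
Lagrange basis. -/
theorem eval_lagr_reflect (ξ : Fin (N + 1) → ℝ) (i : Fin (N + 1)) (x : ℝ) :
    (lagr (fun k => -ξ k.rev) i).eval x = (lagr ξ i.rev).eval (-x) := by
  simp only [lagr, Lagrange.basis, eval_prod, Lagrange.basisDivisor]
  refine Finset.prod_bij (fun j _ => j.rev) ?_ ?_ ?_ ?_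
  · intro j hj
    simpa using hj
  · intro a _ b _ hab
    exact Fin.rev_injective hab
  · intro j hj
    refine ⟨j.rev, ?_, Fin.rev_rev j⟩
    simp only [Finset.mem_erase, Finset.mem_univ, and_true] at hj ⊢
    rintro rfl
    exact hj (Fin.rev_rev j).symm
  · intro j _
    simp only [eval_mul, eval_C, eval_sub, eval_X]
    rw [show -ξ i.rev - -ξ j.rev = -(ξ i.rev - ξ j.rev) by ring, inv_neg]
    ring

theorem wt_reflect (ξ : Fin (N + 1) → ℝ) (i : Fin (N + 1)) :
    wt (fun k => -ξ k.rev) i = wt ξ i.rev := by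
  simp only [wt, eval_lagr_reflect]
  rw [intervalIntegral.integral_comp_neg (fun x => (lagr ξ i.rev).eval x), neg_neg]

theorem IsGaussLobatto.reflect (h : IsGaussLobatto ξ) :
    IsGaussLobatto fun k : Fin (N + 1) => -ξ k.rev := by
  refine ⟨fun a b hab => neg_lt_neg (h.1 (Fin.rev_lt_rev.2 hab)), ?_, ?_, fun f hf => ?_⟩
  · simp [h.2.2.1]
  · simp [h.2.1]
  · simp only [wt_reflect]
    have h1 := h.2.2.2 (f.comp (-X)) (by
      rw [natDegree_comp]; simpa using hf)
    simp only [eval_comp, eval_neg, eval_X] at h1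
    rw [intervalIntegral.integral_comp_neg (fun x => f.eval x), neg_neg] at h1
    rw [h1]
    exact (Equiv.sum_comp Fin.revPerm fun i => wt ξ i * f.eval (-ξ i)).symm

/-- The Gauss–Lobatto weights are symmetric. -/
theorem wt_rev (h : IsGaussLobatto ξ) (i : Fin (N + 1)) : wt ξ i.rev = wt ξ i := by
  rw [← wt_reflect, ← h.unique h.reflect]

end Uniqueness

end DGSEM

namespace DGSEM

/-! ### Algebra of states, block vectors and surface normals. -/

section Vectors

variable {q r : State}

theorem dot3 (u v : Fin 3 → ℝ) : u ⬝ᵥ v = u 0 * v 0 + u 1 * v 1 + u 2 * v 2 := by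
  simp [dotProduct, Fin.sum_univ_three]

theorem dot5 (u v : State) :
    u ⬝ᵥ v = u 0 * v 0 + mid u ⬝ᵥ mid v + u 4 * v 4 := by
  simp [dotProduct, Fin.sum_univ_succ, mid]
  ring

@[simp] theorem pack_zero (a b : ℝ) (m : Fin 3 → ℝ) : pack a m b 0 = a := rfl

@[simp] theorem pack_four (a b : ℝ) (m : Fin 3 → ℝ) : pack a m b 4 = b := rfl

@[simp] theorem mid_pack (a b : ℝ) (m : Fin 3 → ℝ) : mid (pack a m b) = m := by
  ext i; fin_cases i <;> rfl

theorem state_ext (h0 : q 0 = r 0) (hm : mid q = mid r) (h4 : q 4 = r 4) : q = r := by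
  ext i
  have h1 := congrFun hm 0
  have h2 := congrFun hm 1
  have h3 := congrFun hm 2
  fin_cases i
  · exact h0
  · exact h1
  · exact h2
  · exact h3
  · exact h4

theorem mid_sub (q r : State) : mid (q - r) = mid q - mid r := by
  ext i; fin_cases i <;> rfl

theorem mid_eq (h : q 0 ≠ 0) (i : Fin 3) : mid q i = q 0 * vel q i := by
  rw [vel, mul_div_cancel₀ _ h]

theorem dot_ndot (w : State) (v : Fin 3 → ℝ) (F : Block) :
    w ⬝ᵥ ndot v F = ∑ d, v d * (w ⬝ᵥ F d) := by
  simp only [dotProduct, ndot, Finset.mul_sum]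
  rw [Finset.sum_comm]
  exact Finset.sum_congr rfl fun _ _ => Finset.sum_congr rfl fun _ _ => by ring

theorem ndot_neg (v : Fin 3 → ℝ) (F : Block) : ndot (-v) F = -ndot v F := by
  ext a; simp [ndot]

theorem ndot_add (v : Fin 3 → ℝ) (F G : Block) : ndot v (F + G) = ndot v F + ndot v G := by
  ext a; simp [ndot, mul_add, Finset.sum_add_distrib]

theorem area_nonneg (v : Fin 3 → ℝ) : 0 ≤ area v := Real.sqrt_nonneg _

theorem area_neg (v : Fin 3 → ℝ) : area (-v) = area v := by simp [area]

theorem unit_neg (v : Fin 3 → ℝ) : unit (-v) = -unit v := by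
  ext i; simp [unit, area_neg, neg_div]

theorem dot_self_nonneg (v : Fin 3 → ℝ) : 0 ≤ v ⬝ᵥ v := by
  rw [dot3]; nlinarith [mul_self_nonneg (v 0), mul_self_nonneg (v 1), mul_self_nonneg (v 2)]

theorem area_eq_zero {v : Fin 3 → ℝ} (h : area v = 0) : v = 0 := by
  rw [area, Real.sqrt_eq_zero (dot_self_nonneg v)] at h
  exact dotProduct_self_eq_zero.1 h

theorem unit_dot_self {v : Fin 3 → ℝ} (h : area v ≠ 0) : unit v ⬝ᵥ unit v = 1 := by
  have h1 : area v * area v = v ⬝ᵥ v := Real.mul_self_sqrt (dot_self_nonneg v)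
  rw [dot3] at h1 ⊢
  simp only [unit]
  field_simp
  linarith

/-- A vanishing normal is no exception: division by zero makes `unit v` zero. -/
theorem area_mul_unit (v : Fin 3 → ℝ) (i : Fin 3) : area v * unit v i = v i := by
  by_cases h : area v = 0
  · rw [h, area_eq_zero h]; simp
  · rw [unit, mul_div_cancel₀ _ h]

end Vectors

/-! ### The two-point fluxes: symmetry, consistency and entropy conservation. -/

section TwoPoint

variable {γ : ℝ} {q r : State}

theorem avg_comm (a b : ℝ) : avg a b = avg b a := by simp only [avg]; ring

theorem avg_self (a : ℝ) : avg a a = a := by simp [avg]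

theorem logMean_comm (a b : ℝ) : logMean a b = logMean b a := by
  unfold logMean
  by_cases h : a = b
  · simp [h]
  · rw [if_neg h, if_neg (Ne.symm h), ← neg_sub a b, ← neg_sub (Real.log a), neg_div_neg_eq]

theorem logMean_self (a : ℝ) : logMean a a = a := by simp [logMean]

/-- The product form needs no case distinction at `a = b`. Injectivity of the logarithm on the
positive reals excludes a zero denominator otherwise. -/
theorem logMean_mul {a b : ℝ} (ha : 0 < a) (hb : 0 < b) :
    logMean a b * (Real.log b - Real.log a) = b - a := by
  unfold logMean
  split_ifs with h
  · simp [h]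
  · refine div_mul_cancel₀ _ (sub_ne_zero.2 fun hl => h ?_)
    exact (Real.log_injOn_pos (Set.mem_Ioi.2 ha) (Set.mem_Ioi.2 hb) hl.symm)

theorem logMean_ne_zero {a b : ℝ} (ha : 0 < a) (hb : 0 < b) : logMean a b ≠ 0 := by
  intro h0
  have := logMean_mul ha hb
  rw [h0, zero_mul] at this
  have hab : a = b := by linarith
  rw [hab, logMean_self] at h0
  exact hb.ne' h0

theorem pirozzoli_comm : pirozzoli γ q r = pirozzoli γ r q := by
  unfold pirozzoli
  simp only [avg_comm (q 0), avg_comm (vel q _), avg_comm (pres γ q), avg_comm (enth γ q)]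

theorem chandrashekar_comm : chandrashekar γ q r = chandrashekar γ r q := by
  unfold chandrashekar
  simp only [avg_comm (q 0), avg_comm (vel q _), logMean_comm (q 0), avg_comm (q 0 / _),
    logMean_comm (q 0 / _), avg_comm (vel q ⬝ᵥ vel q)]

theorem twoPoint_comm (k : EntropyKind) : twoPoint γ k q r = twoPoint γ k r q := by
  cases k
  · exact pirozzoli_comm
  · exact chandrashekar_comm

/-- The mass flux part of the kinetic energy transported by Pirozzoli's flux. -/
theorem kinetic_dot_twoPoint (d : Fin 3) :
    entVar γ .kinetic q ⬝ᵥ twoPoint γ .kinetic q r d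
      = avg (q 0) (r 0) * avg (vel q d) (vel r d) * (vel q ⬝ᵥ vel r) / 2
        + vel q d * avg (pres γ q) (pres γ r) := by
  rw [dot5]
  simp only [entVar, twoPoint, pirozzoli, pack_zero, pack_four, mid_pack]
  simp only [dot3]
  fin_cases d <;> simp [avg] <;> ring

theorem mul_enth (hγ : 1 < γ) (hq : Admissible γ q) :
    q 0 * enth γ q = pres γ q / (γ - 1) + kin q + pres γ q := by
  have hγ1 : γ - 1 ≠ 0 := by linarith
  have : pres γ q / (γ - 1) = q 4 - kin q := by rw [pres, mul_div_cancel_left₀ _ hγ1]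
  rw [this, enth, mul_div_cancel₀ _ hq.1.ne']; ring

/-- The entropy potential `W · F_e - F^𝓔`. -/
noncomputable def potential (γ : ℝ) : EntropyKind → State → Fin 3 → ℝ
  | .kinetic, q => fun d => pres γ q * vel q d
  | .thermo, q => fun d => q 0 * vel q d

/-- Trades the products $W^TF_e$ of the face terms for entropy flux plus potential, so that only the
potential has to be matched by the numerical flux. -/
theorem entVar_dot_eulerFlux (hγ : 1 < γ) (hq : Admissible γ q) (k : EntropyKind) (d : Fin 3) :
    entVar γ k q ⬝ᵥ eulerFlux γ q d = entFlux γ k q d + potential γ k q d := by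
  have h0 := hq.1.ne'
  have hp := hq.2.ne'
  have hγ1 : γ - 1 ≠ 0 := by linarith
  have he := mul_enth hγ hq
  rw [dot5]
  cases k
  · simp only [entVar, eulerFlux, entFlux, potential, entropy, kin, pack_zero, pack_four, mid_pack]
    simp only [dot3]
    fin_cases d <;> simp <;> ring
  · simp only [entVar, eulerFlux, entFlux, potential, entropy, pack_zero, pack_four, mid_pack, he]
    simp only [dot3, kin]
    fin_cases d <;> simp <;> field_simp <;> ring

theorem beta_pos (hq : Admissible γ q) : 0 < q 0 / (2 * pres γ q) := by
  have := hq.1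
  have := hq.2
  positivity

/-- The logarithmic means in Chandrashekar's flux are those of $\rho$ and $\beta$. In these
variables $s=-(\gamma-1)\ln\rho-\ln(2\beta)$, so jumps of $W$ involve only $\ln\rho$, $\ln\beta$ and
polynomials. -/
theorem entVar_thermo_eq (hγ : 1 < γ) (hq : Admissible γ q) :
    entVar γ .thermo q
      = pack (γ / (γ - 1) + Real.log (q 0) + (Real.log (q 0 / (2 * pres γ q)) + Real.log 2) / (γ - 1)
            - q 0 / (2 * pres γ q) * (vel q ⬝ᵥ vel q))
          (fun i => 2 * (q 0 / (2 * pres γ q)) * vel q i) (-(2 * (q 0 / (2 * pres γ q)))) := by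
  have h0 := hq.1.ne'
  have hp := hq.2.ne'
  have hγ1 : γ - 1 ≠ 0 := by linarith
  rw [Real.log_div h0 (by positivity), Real.log_mul two_ne_zero hp]
  simp only [entVar, physEntropy]
  congr 1
  · field_simp; ring
  · ext i; field_simp
  · field_simp

/-- The entropy conservation condition for Chandrashekar's flux. -/
theorem chandrashekar_conserving (hγ : 1 < γ) (hq : Admissible γ q) (hr : Admissible γ r)
    (d : Fin 3) :
    (entVar γ .thermo r - entVar γ .thermo q) ⬝ᵥ chandrashekar γ q r d
      = r 0 * vel r d - q 0 * vel q d := by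
  have hβq := beta_pos hq
  have hβr := beta_pos hr
  have hγ1 : γ - 1 ≠ 0 := by linarith
  have l1 := logMean_mul hq.1 hr.1
  have l2 := logMean_mul hβq hβr
  have l3 := logMean_ne_zero hβq hβr
  rw [entVar_thermo_eq hγ hq, entVar_thermo_eq hγ hr, dot5]
  simp only [chandrashekar, mid_sub, Pi.sub_apply, pack_zero, pack_four, mid_pack]
  set bq := q 0 / (2 * pres γ q)
  set br := r 0 / (2 * pres γ r)
  -- The logarithmic means are chosen so that jumps of logarithms become linear jumps. With the
  -- means treated as atoms, a polynomial identity remains.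
  have l4 : Real.log br - Real.log bq = (br - bq) / logMean bq br := by
    rw [← l2, mul_div_cancel_left₀ _ l3]
  have l5 : Real.log br = Real.log bq + (br - bq) / logMean bq br := by linarith
  set M := logMean bq br
  set L := logMean (q 0) (r 0)
  rw [l5]
  have l6 : L * Real.log (r 0) = L * Real.log (q 0) + (r 0 - q 0) := by linarith
  have hb : avg bq br ≠ 0 := by unfold avg; positivity
  have hp : 2 * (avg (q 0) (r 0) / (2 * avg bq br)) * avg bq br = avg (q 0) (r 0) := by
    field_simp
  set P := avg (q 0) (r 0) / (2 * avg bq br)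
  have hM : 1 / (2 * (γ - 1) * M) = 1 / M / (γ - 1) / 2 := by field_simp
  have hM' : (br - bq) / M = (br - bq) * (1 / M) := by ring
  rw [hM, hM']
  set m := 1 / M
  -- The product rule for jumps, $[\![\rho
  -- u]\!]=\{\!\{u\}\!\}[\![\rho]\!]+\{\!\{\rho\}\!\}[\![u]\!]$. The mass flux accounts for the
  -- first term and the pressure average for the second.
  have key : ∀ (ur uq : Fin 3 → ℝ) , ur d * r 0 - uq d * q 0
      = avg (uq d) (ur d) * (r 0 - q 0) + avg (q 0) (r 0) * (ur d - uq d) := by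
    intro ur uq; simp only [avg]; ring
  rw [mul_comm (r 0), mul_comm (q 0), key]
  have hL : avg (vel q d) (vel r d) * (r 0 - q 0)
      = avg (vel q d) (vel r d) * L * (Real.log (r 0) - Real.log (q 0)) := by
    rw [← l1]; ring
  rw [hL, ← hp]
  simp only [dot3]
  set lr := Real.log (r 0)
  set lq := Real.log (q 0)
  set lb := Real.log bq
  fin_cases d <;> simp [avg] <;> ring

/-- Consistency of the two-point fluxes. -/
theorem twoPoint_self (hγ : 1 < γ) (hq : Admissible γ q) (k : EntropyKind) :
    twoPoint γ k q q = eulerFlux γ q := by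
  have h0 := hq.1.ne'
  have hp := hq.2.ne'
  have hγ1 : γ - 1 ≠ 0 := by linarith
  ext1 d
  cases k
  · simp only [twoPoint, pirozzoli, avg_self, eulerFlux]
    congr 1
    ring
  · have hpp : q 0 / (2 * (q 0 / (2 * pres γ q))) = pres γ q := by field_simp
    simp only [twoPoint, chandrashekar, avg_self, logMean_self, eulerFlux, hpp, mul_enth hγ hq]
    congr 1
    rw [kin]
    field_simp
    ring

end TwoPoint

end DGSEM

namespace DGSEM

/-! ### Signs and symmetry of the interface dissipation. -/

section Dissipation

variable {γ : ℝ} {q r : State}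

/-- The matrix is a weighted sum of rank-one matrices, so its bilinear form is the weighted sum of
products of wave amplitudes. Keeping the vectors abstract leaves the eigenvectors folded. -/
theorem dot_mulVec_of_rankOne (A B D C p : ℝ) (rm rp r0 : State) (rs : Fin 3 → State)
    (x y : State) :
    x ⬝ᵥ (Matrix.of fun a b => A * (rm a * rm b) + B * (rp a * rp b)
        + D * (C * (r0 a * r0 b) + p * ∑ i, rs i a * rs i b) :
          Matrix (Fin 5) (Fin 5) ℝ).mulVec y
      = A * ((x ⬝ᵥ rm) * (y ⬝ᵥ rm)) + B * ((x ⬝ᵥ rp) * (y ⬝ᵥ rp))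
        + D * (C * ((x ⬝ᵥ r0) * (y ⬝ᵥ r0)) + p * ∑ i, (x ⬝ᵥ rs i) * (y ⬝ᵥ rs i)) := by
  simp only [dotProduct, Matrix.mulVec, Matrix.of_apply, Finset.mul_sum,
    Finset.sum_mul, mul_add, add_mul, Finset.sum_add_distrib]
  congr 1
  · congr 1 <;> rw [Finset.sum_comm] <;>
      exact Finset.sum_congr rfl fun _ _ => Finset.sum_congr rfl fun _ _ => by ring
  · congr 1
    · rw [Finset.sum_comm]
      exact Finset.sum_congr rfl fun _ _ => Finset.sum_congr rfl fun _ _ => by ring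
    · rw [Finset.sum_congr rfl fun _ _ => Finset.sum_comm, Finset.sum_comm]
      refine Finset.sum_congr rfl fun _ _ => ?_
      rw [Finset.sum_comm]
      exact Finset.sum_congr rfl fun _ _ => Finset.sum_congr rfl fun _ _ => by ring

/-- The quadratic form of the matrix dissipation. -/
theorem dot_roeMatrix_mulVec (γ ρ p : ℝ) (u n : Fin 3 → ℝ) (x y : State) :
    x ⬝ᵥ (roeMatrix γ ρ p u n).mulVec y =
      let c := √(γ * p / ρ)
      let un := u ⬝ᵥ n
      let h := c ^ 2 / (γ - 1) + (u ⬝ᵥ u) / 2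
      let rm := pack 1 (fun i => u i - c * n i) (h - c * un)
      let rp := pack 1 (fun i => u i + c * n i) (h + c * un)
      let r0 := pack 1 u ((u ⬝ᵥ u) / 2)
      let rs : Fin 3 → State := fun i =>
        pack 0 (fun j => (if i = j then 1 else 0) - n i * n j) (u i - n i * un)
      |un - c| * (ρ / (2 * γ)) * ((x ⬝ᵥ rm) * (y ⬝ᵥ rm))
        + |un + c| * (ρ / (2 * γ)) * ((x ⬝ᵥ rp) * (y ⬝ᵥ rp))
        + |un| * ((γ - 1) * ρ / γ * ((x ⬝ᵥ r0) * (y ⬝ᵥ r0))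
          + p * ∑ i, (x ⬝ᵥ rs i) * (y ⬝ᵥ rs i)) :=
  dot_mulVec_of_rankOne _ _ _ _ _ _ _ _ _ _ _

theorem roeMatrix_nonneg (hγ : 1 < γ) {ρ p : ℝ} (hρ : 0 < ρ) (hp : 0 < p) (u n : Fin 3 → ℝ)
    (x : State) : 0 ≤ x ⬝ᵥ (roeMatrix γ ρ p u n).mulVec x := by
  rw [dot_roeMatrix_mulVec]
  have h1 : 0 ≤ ρ / (2 * γ) := by positivity
  have h2 : 0 ≤ (γ - 1) * ρ / γ := div_nonneg (mul_nonneg (by linarith) hρ.le) (by linarith)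
  refine add_nonneg (add_nonneg ?_ ?_) (mul_nonneg (abs_nonneg _) (add_nonneg ?_ ?_))
  · exact mul_nonneg (mul_nonneg (abs_nonneg _) h1) (mul_self_nonneg _)
  · exact mul_nonneg (mul_nonneg (abs_nonneg _) h1) (mul_self_nonneg _)
  · exact mul_nonneg h2 (mul_self_nonneg _)
  · exact mul_nonneg hp.le (Finset.sum_nonneg fun _ _ => mul_self_nonneg _)

/-- Reversing the normal exchanges the two acoustic waves together with the moduli of their speeds.
The contributions of the entropy and shear waves are even in the normal. -/
theorem roeMatrix_neg (γ ρ p : ℝ) (u n : Fin 3 → ℝ) :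
    roeMatrix γ ρ p u (-n) = roeMatrix γ ρ p u n := by
  ext a b
  simp only [roeMatrix, Matrix.of_apply, dotProduct_neg, Pi.neg_apply, mul_neg, sub_neg_eq_add,
    ← sub_eq_add_neg, neg_mul, neg_neg, abs_neg]
  rw [show ∀ x y : ℝ, |-x - y| = |x + y| from fun x y => by rw [← abs_neg]; congr 1; ring,
    show ∀ x y : ℝ, |-x + y| = |x - y| from fun x y => by rw [← abs_neg]; congr 1; ring]
  ring

theorem waveSpeed_nonneg (γ : ℝ) (n : Fin 3 → ℝ) (q r : State) : 0 ≤ waveSpeed γ n q r :=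
  le_max_of_le_left (add_nonneg (abs_nonneg _) (Real.sqrt_nonneg _))

/-- This makes the interface flux conservative: seen from the other side it changes sign. The
symmetry of the averages $\hat\rho,\hat p$ is needed here. -/
theorem dissip_swap (k : EntropyKind) {c : Interface} (hc : c.Proper γ) (n : Fin 3 → ℝ) :
    dissip γ k c (-n) r q = -dissip γ k c n q r := by
  cases c with
  | conserving => cases k <;> simp [dissip]
  | dissipative rh ph =>
    cases k
    · simp only [dissip]
      rw [← smul_neg, neg_sub]
      congr 1
      simp only [waveSpeed, dotProduct_neg, abs_neg]
      exact max_comm _ _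
    · simp only [dissip]
      rw [← Matrix.mulVec_neg, neg_sub, roeMatrix_neg, (hc.1 r q).1, (hc.1 r q).2]
      simp only [avg_comm (vel r _)]

theorem numFlux_swap (k : EntropyKind) {c : Interface} (hc : c.Proper γ) (v : Fin 3 → ℝ) :
    numFlux γ k c (-v) r q = -numFlux γ k c v q r := by
  rw [numFlux, numFlux, area_neg, unit_neg, dissip_swap k hc, twoPoint_comm, ndot_neg, smul_neg]
  abel

/-- The jump of the kinetic-energy variables against the jump of the state. -/
theorem kinetic_jump (hq : q 0 ≠ 0) (hr : r 0 ≠ 0) :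
    (entVar γ .kinetic r - entVar γ .kinetic q) ⬝ᵥ (r - q)
      = avg (q 0) (r 0) * ((vel r - vel q) ⬝ᵥ (vel r - vel q)) := by
  rw [dot5]
  simp only [entVar, mid_sub, Pi.sub_apply, pack_zero, pack_four, mid_pack]
  simp only [dot3, Pi.sub_apply, mid_eq hq, mid_eq hr, avg]
  ring

theorem dissip_nonneg (hγ : 1 < γ) (k : EntropyKind) {c : Interface} (hc : c.Proper γ)
    (hq : Admissible γ q) (hr : Admissible γ r) (n : Fin 3 → ℝ) :
    0 ≤ (entVar γ k r - entVar γ k q) ⬝ᵥ dissip γ k c n q r := by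
  cases c with
  | conserving => cases k <;> simp [dissip]
  | dissipative rh ph =>
    cases k
    · simp only [dissip]
      rw [dotProduct_smul, kinetic_jump hq.1.ne' hr.1.ne', smul_eq_mul]
      refine mul_nonneg (waveSpeed_nonneg _ _ _ _) (mul_nonneg ?_ (dot_self_nonneg _))
      have := hq.1
      have := hr.1
      unfold avg
      positivity
    · exact roeMatrix_nonneg hγ (hc.2 q r hq hr).1 (hc.2 q r hq hr).2 _ _ _

/-- The entropy production of the two-point flux at an interior face. -/
theorem twoPoint_jump (hγ : 1 < γ) (k : EntropyKind) (hq : Admissible γ q) (hr : Admissible γ r)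
    (d : Fin 3) :
    (entVar γ k r - entVar γ k q) ⬝ᵥ twoPoint γ k q r d
      = potential γ k r d - potential γ k q d
        - k.theta * (avg (vel q d) (vel r d) * (pres γ r - pres γ q)) := by
  cases k
  -- The convective part is symmetric in the two states and cancels. The pressure leaves
  -- $[\![u]\!]\{\!\{p\}\!\}=[\![pu]\!]-\{\!\{u\}\!\}[\![p]\!]$.
  · rw [sub_dotProduct, kinetic_dot_twoPoint, twoPoint_comm, kinetic_dot_twoPoint]
    simp only [potential, EntropyKind.theta, dotProduct_comm (vel r), avg]
    ring
  · rw [twoPoint, chandrashekar_conserving hγ hq hr]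
    simp [potential, EntropyKind.theta]

end Dissipation

/-! ### Inviscid walls through the ghost state. -/

section Walls

variable {γ : ℝ} {q : State} {n : Fin 3 → ℝ}

theorem ghost_zero (n : Fin 3 → ℝ) (q : State) : ghost n q 0 = q 0 := rfl

theorem vel_ghost (hq : q 0 ≠ 0) (n : Fin 3 → ℝ) (i : Fin 3) :
    vel (ghost n q) i = vel q i - 2 * (vel q ⬝ᵥ n) * n i := by
  have : mid q ⬝ᵥ n = q 0 * (vel q ⬝ᵥ n) := by
    simp only [dot3, mid_eq hq]; ring
  rw [vel, ghost, mid_pack, pack_zero, this, mid_eq hq]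
  field_simp

theorem vel_ghost_dot_self (hq : q 0 ≠ 0) (hn : n ⬝ᵥ n = 1) :
    vel (ghost n q) ⬝ᵥ vel (ghost n q) = vel q ⬝ᵥ vel q := by
  have h1 : vel (ghost n q) ⬝ᵥ vel (ghost n q)
      = vel q ⬝ᵥ vel q + 4 * (vel q ⬝ᵥ n) ^ 2 * (n ⬝ᵥ n - 1) := by
    simp only [dot3, vel_ghost hq]; ring
  rw [h1, hn]; ring

theorem kin_ghost (hq : q 0 ≠ 0) (hn : n ⬝ᵥ n = 1) : kin (ghost n q) = kin q := by
  rw [kin, kin, vel_ghost_dot_self hq hn, ghost_zero]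

theorem pres_ghost (hq : q 0 ≠ 0) (hn : n ⬝ᵥ n = 1) : pres γ (ghost n q) = pres γ q := by
  rw [pres, pres, kin_ghost hq hn]; rfl

theorem admissible_ghost (hq : Admissible γ q) (hn : n ⬝ᵥ n = 1) :
    Admissible γ (ghost n q) :=
  ⟨hq.1, by rw [pres_ghost hq.1.ne' hn]; exact hq.2⟩

/-- The mean of a velocity and its reflection is tangential, so no mass crosses the wall. Both wall
estimates rest on this. -/
theorem avg_vel_ghost_dot (hq : q 0 ≠ 0) (hn : n ⬝ᵥ n = 1) :
    (fun i => avg (vel q i) (vel (ghost n q) i)) ⬝ᵥ n = 0 := by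
  have h1 : (fun i => avg (vel q i) (vel (ghost n q) i)) ⬝ᵥ n
      = (vel q ⬝ᵥ n) * (1 - n ⬝ᵥ n) := by
    simp only [dot3, vel_ghost hq, avg]; ring
  rw [h1, hn]; ring

/-- The two-point flux with the ghost state produces no entropy at a wall. -/
theorem twoPoint_ghost (k : EntropyKind) (hq : Admissible γ q) (hn : n ⬝ᵥ n = 1) :
    entVar γ k q ⬝ᵥ ndot n (twoPoint γ k q (ghost n q)) = n ⬝ᵥ potential γ k q := by
  have h0 := hq.1.ne'
  have hp := hq.2.ne'
  have hu := avg_vel_ghost_dot h0 hn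
  rw [dot_ndot]
  cases k
  · simp only [kinetic_dot_twoPoint, pres_ghost h0 hn, avg_self, ghost_zero, potential]
    have h1 : ∀ a b : ℝ, ∑ d, n d * (q 0 * avg (vel q d) (vel (ghost n q) d) * a / 2
        + vel q d * b)
        = q 0 * a / 2 * ((fun i => avg (vel q i) (vel (ghost n q) i)) ⬝ᵥ n)
          + n ⬝ᵥ fun d => b * vel q d := by
      intro a b
      simp only [dot3, Fin.sum_univ_three]; ring
    rw [h1, hu]; ring
  · have hβ : (q 0 / (2 * pres γ q)) ≠ 0 := (beta_pos hq).ne'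
    -- All terms except the momentum pressure carry the factor $\{\!\{u_d\}\!\}$ and disappear after
    -- contraction with the normal. The pressure tested with $W$ is the potential $\rho u_d$.
    have h1 : ∀ d, entVar γ .thermo q ⬝ᵥ twoPoint γ .thermo q (ghost n q) d
        = (entVar γ .thermo q ⬝ᵥ pack (q 0) (fun i => q 0 * avg (vel q i) (vel (ghost n q) i))
            (q 0 * (1 / (2 * (γ - 1) * (q 0 / (2 * pres γ q)))
              - (vel q ⬝ᵥ vel q) / 2
              + (fun i => avg (vel q i) (vel (ghost n q) i)) ⬝ᵥ
                (fun i => avg (vel q i) (vel (ghost n q) i)))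
              + pres γ q)) * avg (vel q d) (vel (ghost n q) d)
          + q 0 * vel q d := by
      intro d
      have hpp : q 0 / (2 * (q 0 / (2 * pres γ q))) = pres γ q := by field_simp
      simp only [twoPoint, chandrashekar, pres_ghost h0 hn, ghost_zero, vel_ghost_dot_self h0 hn,
        avg_self, logMean_self, hpp]
      rw [dot5, dot5]
      simp only [pack_zero, pack_four, mid_pack]
      have hw : ∀ i, mid (entVar γ .thermo q) i * pres γ q = q 0 * vel q i := by
        intro i
        simp only [entVar, mid_pack]
        field_simp
      rw [← hw d]
      simp only [dot3]
      fin_cases d <;> simp <;> ring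
    simp only [h1, potential]
    have h2 : ∀ a : ℝ, ∑ d, n d * (a * avg (vel q d) (vel (ghost n q) d) + q 0 * vel q d)
        = a * ((fun i => avg (vel q i) (vel (ghost n q) i)) ⬝ᵥ n)
          + n ⬝ᵥ fun d => q 0 * vel q d := by
      intro a
      simp only [dot3, Fin.sum_univ_three]; ring
    rw [h2, hu]; ring

/-- Reflection keeps density, pressure and speed, so only the normal momentum component of $W$
jumps. -/
theorem entVar_thermo_ghost_sub (hq : Admissible γ q) (hn : n ⬝ᵥ n = 1) :
    entVar γ .thermo (ghost n q) - entVar γ .thermo q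
      = pack 0 (fun i => -(2 * (q 0 / pres γ q) * (vel q ⬝ᵥ n)) * n i) 0 := by
  have h0 := hq.1.ne'
  refine state_ext ?_ ?_ ?_
  · simp [entVar, physEntropy, pres_ghost h0 hn, vel_ghost_dot_self h0 hn, ghost_zero]
  · ext i
    simp only [mid_sub, entVar, mid_pack, Pi.sub_apply, pres_ghost h0 hn, ghost_zero, vel_ghost h0]
    ring
  · simp [entVar, pres_ghost h0 hn, ghost_zero]

/-- Here the dissipation is tested with the inner $W$ alone, not with a jump. For the kinetic energy
the product is $-2\rho u_n^2$ times the wave speed. For the thermodynamic entropy the mean velocity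
is tangential, so only the two acoustic waves act, with equal weights and opposite jump amplitudes,
and they combine to minus a square. -/
theorem dissip_ghost (hγ : 1 < γ) (k : EntropyKind) {c : Interface} (hc : c.Proper γ)
    (hq : Admissible γ q) (hn : n ⬝ᵥ n = 1) :
    entVar γ k q ⬝ᵥ dissip γ k c n q (ghost n q) ≤ 0 := by
  have h0 := hq.1.ne'
  cases c with
  | conserving => cases k <;> simp [dissip]
  | dissipative rh ph =>
    cases k
    · simp only [dissip]
      rw [dotProduct_smul, smul_eq_mul]
      refine mul_nonpos_of_nonneg_of_nonpos (waveSpeed_nonneg _ _ _ _) ?_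
      have h1 : entVar γ .kinetic q ⬝ᵥ (ghost n q - q) = -(2 * q 0 * (vel q ⬝ᵥ n) ^ 2) := by
        rw [dot5]
        simp only [entVar, mid_sub, pack_zero, pack_four, mid_pack, Pi.sub_apply, ghost_zero]
        simp only [dot3, ghost, mid_pack, Pi.sub_apply, mid_eq h0]
        ring
      rw [h1]
      have := hq.1
      have : 0 ≤ 2 * q 0 * (vel q ⬝ᵥ n) ^ 2 := by positivity
      linarith
    · have hpos := hc.2 q _ hq (admissible_ghost hq hn)
      simp only [dissip]
      have hun' := avg_vel_ghost_dot h0 hn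
      -- Of the averaged velocity only its tangentiality is used from here on.
      generalize (fun i => avg (vel q i) (vel (ghost n q) i)) = u at hun' ⊢
      rw [dot_roeMatrix_mulVec, hun', entVar_thermo_ghost_sub hq hn]
      set ρ := rh q (ghost n q)
      set p := ph q (ghost n q)
      set c := √(γ * p / ρ)
      have hun : n ⬝ᵥ u = 0 := by rw [dotProduct_comm]; exact hun'
      set b := q 0 / pres γ q with hb
      have hbpos : 0 < b := div_pos hq.1 hq.2
      set s := vel q ⬝ᵥ n with hs
      have e1 : ∀ h : ℝ, pack 0 (fun i => -(2 * b * s) * n i) 0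
          ⬝ᵥ pack 1 (fun i => u i - c * n i) h = 2 * b * s * c := by
        intro h
        rw [dot5]
        simp only [pack_zero, pack_four, mid_pack]
        have : (fun i => -(2 * b * s) * n i) ⬝ᵥ (fun i => u i - c * n i)
            = -(2 * b * s) * (n ⬝ᵥ u) + 2 * b * s * c * (n ⬝ᵥ n) := by
          simp only [dot3]; ring
        rw [this, hn, hun]; ring
      have e2 : ∀ h : ℝ, pack 0 (fun i => -(2 * b * s) * n i) 0
          ⬝ᵥ pack 1 (fun i => u i + c * n i) h = -(2 * b * s * c) := by
        intro h
        rw [dot5]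
        simp only [pack_zero, pack_four, mid_pack]
        have : (fun i => -(2 * b * s) * n i) ⬝ᵥ (fun i => u i + c * n i)
            = -(2 * b * s) * (n ⬝ᵥ u) - 2 * b * s * c * (n ⬝ᵥ n) := by
          simp only [dot3]; ring
        rw [this, hn, hun]; ring
      -- Only the difference of the two acoustic amplitudes of $W$ enters, and in it the density and
      -- energy components drop out.
      have e3 : ∀ h : ℝ, entVar γ .thermo q ⬝ᵥ pack 1 (fun i => u i - c * n i) h
          - entVar γ .thermo q ⬝ᵥ pack 1 (fun i => u i + c * n i) h = -(2 * b * c * s) := by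
        intro h
        rw [dot5, dot5]
        simp only [entVar, pack_zero, pack_four, mid_pack]
        simp only [hs, hb, dot3]
        ring
      simp only [e1, e2, zero_sub, zero_add, abs_neg, abs_zero, zero_mul, add_zero, mul_zero,
        sub_zero]
      set h := c ^ 2 / (γ - 1) + u ⬝ᵥ u / 2
      have h3 := e3 h
      have hρ : 0 ≤ ρ / (2 * γ) := div_nonneg hpos.1.le (by linarith)
      have h4 : |c| * (ρ / (2 * γ)) * (entVar γ .thermo q ⬝ᵥ pack 1 (fun i => u i - c * n i) h
            * (2 * b * s * c))
          + |c| * (ρ / (2 * γ)) * (entVar γ .thermo q ⬝ᵥ pack 1 (fun i => u i + c * n i) h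
            * -(2 * b * s * c))
          = -(|c| * (ρ / (2 * γ)) * (2 * b * s * c) ^ 2) := by
        rw [sub_eq_iff_eq_add.1 h3]; ring
      rw [h4]
      have := mul_nonneg (mul_nonneg (abs_nonneg c) hρ) (sq_nonneg (2 * b * s * c))
      linarith

/-- The entropy balance of the inviscid flux at a wall. -/
theorem numFlux_ghost (hγ : 1 < γ) (k : EntropyKind) {c : Interface} (hc : c.Proper γ)
    (hq : Admissible γ q) (v : Fin 3 → ℝ) :
    v ⬝ᵥ potential γ k q ≤ entVar γ k q ⬝ᵥ numFlux γ k c v q (ghost (unit v) q) ∧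
      (c = .conserving →
        entVar γ k q ⬝ᵥ numFlux γ k c v q (ghost (unit v) q) = v ⬝ᵥ potential γ k q) := by
  -- If the normal vanishes, `unit v` is not a unit vector and the ghost identities do not apply,
  -- but then both sides are zero.
  by_cases ha : area v = 0
  · have hv := area_eq_zero ha
    have hz : entVar γ k q ⬝ᵥ numFlux γ k c v q (ghost (unit v) q) = v ⬝ᵥ potential γ k q := by
      rw [numFlux, ha, dotProduct_sub, dot_ndot, hv]
      simp
    exact ⟨hz.ge, fun _ => hz⟩
  · have hn := unit_dot_self ha
    have hv : v = area v • unit v := by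
      ext i; simp [area_mul_unit]
    have h1 : entVar γ k q ⬝ᵥ ndot v (twoPoint γ k q (ghost (unit v) q))
        = v ⬝ᵥ potential γ k q := by
      have h2 := twoPoint_ghost k hq hn
      rw [dot_ndot] at h2 ⊢
      have h3 : v ⬝ᵥ potential γ k q = area v * (unit v ⬝ᵥ potential γ k q) := by
        conv_lhs => rw [hv]
        rw [smul_dotProduct, smul_eq_mul]
      rw [h3, ← h2, Finset.mul_sum]
      refine Finset.sum_congr rfl fun d _ => ?_
      rw [← mul_assoc, area_mul_unit]
    have h2 := dissip_ghost hγ k hc hq hn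
    rw [numFlux, dotProduct_sub, h1, dotProduct_smul, smul_eq_mul]
    refine ⟨?_, ?_⟩
    · have := mul_nonneg (div_nonneg (area_nonneg v) two_pos.le) (neg_nonneg.2 h2)
      linarith
    · rintro rfl
      cases k <;> simp [dissip]

end Walls

end DGSEM

namespace DGSEM

/-! ### Dissipativity of the Navier–Stokes flux. -/

section Viscous

/-- The coefficient $2/3$ removes exactly the trace part: the diagonal entries contribute only
through their differences, the others through symmetrized sums, all squared. -/
theorem stress_nonneg {μ : ℝ} (hμ : 0 ≤ μ) (A : Fin 3 → Fin 3 → ℝ) :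
    0 ≤ ∑ d, ∑ i, A i d * (μ * (A i d + A d i - if i = d then 2 / 3 * ∑ m, A m m else 0)) := by
  have h : ∑ d, ∑ i, A i d * (μ * (A i d + A d i - if i = d then 2 / 3 * ∑ m, A m m else 0))
      = μ * ((A 0 1 + A 1 0) ^ 2 + (A 0 2 + A 2 0) ^ 2 + (A 1 2 + A 2 1) ^ 2
        + 2 / 3 * ((A 0 0 - A 1 1) ^ 2 + (A 0 0 - A 2 2) ^ 2 + (A 1 1 - A 2 2) ^ 2)) := by
    simp [Fin.sum_univ_three]
    ring
  rw [h]
  positivity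

/-- For the thermodynamic entropy, $G^TF_v$ is $\frac{\rho}{p}\nabla\vec u:\tau$ plus
$\frac{\kappa}{R}(p/\rho)^2$ times the squared gradient of $w_5$; the work of the stress is absorbed
by the definition of `velGrad`. For the kinetic energy `hG` removes both that work and the heat
flux. -/
theorem viscFlux_dissipative {g : Gas} (hγ : 1 < g.γ) (hR : 0 < g.R) (hPr : 0 < g.Pr)
    (hμ : 0 ≤ g.μ) (k : EntropyKind) {q : State} (hq : Admissible g.γ q) (G : Block)
    (gT : Fin 3 → ℝ) (hG : k = .kinetic → ∀ d, G d 4 = 0) :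
    0 ≤ ∑ d, G d ⬝ᵥ viscFlux g k q G gT d := by
  have hκ : 0 ≤ g.κ := by
    have : 0 < g.γ - 1 := by linarith
    unfold Gas.κ
    positivity
  have hs := stress_nonneg hμ (velGrad g.γ k q G)
  have h0 := hq.1
  have hp := hq.2
  simp only [dot5, viscFlux, pack_zero, pack_four, mid_pack]
  cases k
  · have h4 := hG rfl
    simp only [h4, mul_zero, zero_mul, add_zero, zero_add]
    exact hs
  · generalize hB : (fun i d => g.μ * (velGrad g.γ .thermo q G i d + velGrad g.γ .thermo q G d i
      - if i = d then 2 / 3 * ∑ m, velGrad g.γ .thermo q G m m else 0)) = B at hs ⊢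
    have hBe : ∀ i d, g.μ * (velGrad g.γ .thermo q G i d + velGrad g.γ .thermo q G d i
      - if i = d then 2 / 3 * ∑ m, velGrad g.γ .thermo q G m m else 0) = B i d := fun i d => by
      rw [← hB]
    simp only [hBe] at hs ⊢
    have key : ∑ d, (G d 0 * 0 + mid (G d) ⬝ᵥ (fun i => B i d) + G d 4 *
          (∑ i, B i d * vel q i + g.κ * tempGrad g .thermo q G gT d))
        = q 0 / pres g.γ q * (∑ d, ∑ i, velGrad g.γ .thermo q G i d * B i d)
          + g.κ * (pres g.γ q / q 0) ^ 2 / g.R * ∑ d, G d 4 ^ 2 := by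
      simp only [Fin.sum_univ_three, dot3, velGrad, tempGrad]
      field_simp
      ring
    rw [key]
    refine add_nonneg (mul_nonneg (by positivity) hs)
      (mul_nonneg (by positivity) (Finset.sum_nonneg fun _ _ => sq_nonneg _))

end Viscous

/-! ### Dissipativity of the filtered artificial flux. -/

section Filter

variable {N : ℕ} {ξ : Fin (N + 1) → ℝ} {E : Type*}

/-- The quadrature of a nodal field against a tensor-product Legendre polynomial. -/
noncomputable def legPair (ξ : Fin (N + 1) → ℝ) (f : Node N → ℝ) (m : Node N) : ℝ :=
  ∑ x, wt3 ξ x * f x * ∏ d, (legendre (m d)).eval (ξ (x d))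

/-- The filter in modal space. -/
theorem sum_mul_filt (K f g : Node N → ℝ) :
    ∑ x, wt3 ξ x * (f x * filt ξ K g x)
      = ∑ m, K m / (∏ d, legNormSq ξ (m d)) * (legPair ξ f m * legPair ξ g m) := by
  simp only [filt, Finset.mul_sum]
  rw [Finset.sum_comm]
  refine Finset.sum_congr rfl fun m _ => ?_
  simp only [legPair, modal]
  generalize ∑ x, wt3 ξ x * g x * ∏ d, (legendre (m d)).eval (ξ (x d)) = b
  simp only [Finset.mul_sum, Finset.sum_mul]
  exact Finset.sum_congr rfl fun x _ => by ring

theorem filter_coeff_nonneg (h : IsGaussLobatto ξ) {K : Node N → ℝ} (hK : ∀ m, 0 ≤ K m)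
    (m : Node N) : 0 ≤ K m / ∏ d, legNormSq ξ (m d) :=
  div_nonneg (hK m) (Finset.prod_nonneg fun _ _ =>
    Finset.sum_nonneg fun i _ => mul_nonneg (wt_pos h i).le (sq_nonneg _))

theorem sum_mul_filt_self_nonneg (h : IsGaussLobatto ξ) {K : Node N → ℝ} (hK : ∀ m, 0 ≤ K m)
    (f : Node N → ℝ) : 0 ≤ ∑ x, wt3 ξ x * (f x * filt ξ K f x) := by
  rw [sum_mul_filt]
  exact Finset.sum_nonneg fun m _ =>
    mul_nonneg (filter_coeff_nonneg h hK m) (mul_self_nonneg _)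

/-- In Legendre space the filter is diagonal, and a spatially constant `C` acts on the coefficients
of each mode separately. The form is therefore a nonnegative combination, over modes, of quadratic
forms of `C`. -/
theorem sum_quadratic_filt_nonneg {ι : Type*} [Fintype ι] (h : IsGaussLobatto ξ)
    {K : Node N → ℝ} (hK : ∀ m, 0 ≤ K m) {C : Matrix ι ι ℝ} (hC : C.PosSemidef)
    (f : ι → Node N → ℝ) :
    0 ≤ ∑ a, ∑ b, C a b * ∑ x, wt3 ξ x * (f a x * filt ξ K (f b) x) := by
  simp only [sum_mul_filt, Finset.mul_sum]
  rw [Finset.sum_congr rfl fun _ _ => Finset.sum_comm, Finset.sum_comm]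
  refine Finset.sum_nonneg fun m _ => ?_
  have h1 := hC.dotProduct_mulVec_nonneg fun a => legPair ξ (f a) m
  have h2 := mul_nonneg (filter_coeff_nonneg h hK m) h1
  convert h2 using 1
  simp only [dotProduct, Matrix.mulVec, Finset.mul_sum]
  refine Finset.sum_congr rfl fun a _ => Finset.sum_congr rfl fun b _ => ?_
  simp only [Pi.star_apply, star_trivial]
  ring

/-- Multiplied by the Jacobian of the volume quadrature, the factor outside the filter becomes the
one inside, which makes the dissipation a symmetric form. -/
theorem mul_sqrt_div {J α : ℝ} (hJ : 0 < J) : J * √(α / J) = √(J * α) := by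
  rw [Real.sqrt_div' _ hJ.le, Real.sqrt_mul hJ.le]
  have h1 := Real.mul_self_sqrt hJ.le
  have h2 : √J ≠ 0 := (Real.sqrt_pos.2 hJ).ne'
  field_simp
  rw [sq, h1, mul_comm]

/-- The filtered artificial flux is dissipative. -/
theorem filtFlux_dissipative (h : IsGaussLobatto ξ) {K J : Node N → ℝ} (hK : ∀ m, 0 ≤ K m)
    (hJ : ∀ x, 0 < J x) (G : Node N → Block) (e : E) {A : ArtVisc N E} (hA : A.Nonneg) :
    0 ≤ ∑ x, wt3 ξ x * (J x * ∑ d, G x d ⬝ᵥ filtFlux ξ K J G e A x d) := by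
  have hsum : ∀ x (F : Block), ∑ d, G x d ⬝ᵥ F d = ∑ k : Fin 3 × Fin 5, G x k.1 k.2 * F k.1 k.2 :=
    fun x F => by rw [Fintype.sum_prod_type]; rfl
  simp only [hsum]
  cases A with
  | svv2 α C =>
    refine (sum_quadratic_filt_nonneg h hK hA.2
      fun k z => √(J z * α e z) * G z k.1 k.2).trans_eq ?_
    simp only [filtFlux, Finset.mul_sum]
    rw [Finset.sum_congr rfl fun _ _ => Finset.sum_comm, Finset.sum_comm]
    refine Finset.sum_congr rfl fun x _ => Finset.sum_congr rfl fun a _ =>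
      Finset.sum_congr rfl fun b _ => ?_
    rw [← mul_sqrt_div (hJ x)]
    ring
  | svv3 L D =>
    -- Moving `L` and $\sqrt{D}$ onto `G` pairs, for each component `k`, the field
    -- $\sqrt{JD_k}\,(LG)_k$ with its own filtered version. Hence `L` and `D` may vary in space.
    have h1 : ∀ k : Fin 3 × Fin 5, 0 ≤ ∑ x, wt3 ξ x *
        ((√(J x * D e x k) * ∑ l, L e x k l * G x l.1 l.2) *
          filt ξ K (fun z => √(J z * D e z k) * ∑ l, L e z k l * G z l.1 l.2) x) :=
      fun k => sum_mul_filt_self_nonneg h hK _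
    refine (Finset.sum_nonneg fun k (_ : k ∈ Finset.univ) => h1 k).trans_eq ?_
    rw [Finset.sum_comm]
    refine Finset.sum_congr rfl fun x _ => ?_
    rw [← Finset.mul_sum]
    congr 1
    have hs : J x * (1 / √(J x)) = √(J x) := by
      have h1 := Real.mul_self_sqrt (hJ x).le
      have h2 : √(J x) ≠ 0 := (Real.sqrt_pos.2 (hJ x)).ne'
      field_simp
      rw [sq, h1]
    simp only [filtFlux]
    generalize hF : (fun k => filt ξ K
      (fun z => √(J z * D e z k) * ∑ l, L e z k l * G z l.1 l.2) x) = F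
    have hFk : ∀ k, filt ξ K
      (fun z => √(J z * D e z k) * ∑ l, L e z k l * G z l.1 l.2) x = F k := fun k => by rw [← hF]
    simp only [hFk]
    simp only [Real.sqrt_mul (hJ x).le, Finset.mul_sum, Finset.sum_mul]
    rw [Finset.sum_comm]
    refine Finset.sum_congr rfl fun a _ => Finset.sum_congr rfl fun b _ => ?_
    simp only [Prod.mk.eta]
    linear_combination (-(√(D e x b) * L e x b a * G x a.1 a.2 * F b)) * hs

end Filter

/-! ### The chain rule in time. -/

section EntropyDerivative

variable {γ : ℝ} {T : Set ℝ} {t : ℝ} {q : ℝ → State} {q' : State}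

/-- A single quotient of conserved components, to which the quotient rule applies directly. -/
theorem kin_eq (q : State) : kin q = (q 1 ^ 2 + q 2 ^ 2 + q 3 ^ 2) / (2 * q 0) := by
  have h : kin q = q 0 * ((q 1 / q 0) * (q 1 / q 0) + (q 2 / q 0) * (q 2 / q 0)
      + (q 3 / q 0) * (q 3 / q 0)) / 2 := by rw [kin, dot3]; rfl
  rw [h]
  by_cases h0 : q 0 = 0
  · simp [h0]
  · field_simp

theorem hasDerivWithinAt_kin (hq : ∀ a, HasDerivWithinAt (fun s => q s a) (q' a) T t)
    (h0 : q t 0 ≠ 0) :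
    HasDerivWithinAt (fun s => kin (q s)) (q' ⬝ᵥ entVar γ .kinetic (q t)) T t := by
  simp only [kin_eq]
  have h := ((((hq 1).pow 2).add ((hq 2).pow 2)).add ((hq 3).pow 2)).div ((hq 0).const_mul 2)
    (mul_ne_zero two_ne_zero h0)
  refine (h.congr_deriv ?_)
  rw [dot5]
  simp only [entVar, pack_zero, pack_four, mid_pack]
  simp only [dot3, vel, mid]
  simp
  field_simp
  ring

/-- The chain rule `𝓔_t = wᵀ q_t`. -/
theorem hasDerivWithinAt_entropy (hγ : 1 < γ) (k : EntropyKind)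
    (hq : ∀ a, HasDerivWithinAt (fun s => q s a) (q' a) T t) (hadm : Admissible γ (q t)) :
    HasDerivWithinAt (fun s => entropy γ k (q s)) (q' ⬝ᵥ entVar γ k (q t)) T t := by
  have h0 := hadm.1.ne'
  have hk := hasDerivWithinAt_kin (γ := γ) hq h0
  cases k
  · exact hk
  · have hp : HasDerivWithinAt (fun s => pres γ (q s))
        ((γ - 1) * (q' 4 - q' ⬝ᵥ entVar γ .kinetic (q t))) T t :=
      ((hq 4).sub hk).const_mul (γ - 1)
    have hs := (hp.log hadm.2.ne').sub (((hq 0).log h0).const_mul γ)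
    have h := (((hq 0).mul hs).neg).div_const (γ - 1)
    refine h.congr_deriv ?_
    have hpp := hadm.2.ne'
    have hγ1 : γ - 1 ≠ 0 := by linarith
    rw [dot5, dot5]
    simp only [entVar, physEntropy, pack_zero, pack_four, mid_pack, Pi.sub_apply]
    simp only [dot3]
    field_simp
    ring

end EntropyDerivative

end DGSEM

namespace DGSEM

namespace Setup

variable {N : ℕ} {E Fi Fb : Type*} {S : Setup N E Fi Fb} {U : Snapshot N E}

/-! ### Quadrature over an element and its boundary. -/

section Quadrature

theorem vol_add (f g : Node N → ℝ) : S.vol (fun x => f x + g x) = S.vol f + S.vol g := by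
  simp [vol, mul_add, Finset.sum_add_distrib]

theorem vol_nonneg (h : IsGaussLobatto S.ξ) {f : Node N → ℝ} (hf : ∀ x, 0 ≤ f x) :
    0 ≤ S.vol f :=
  Finset.sum_nonneg fun x _ => mul_nonneg (wt3_pos h x).le (hf x)

theorem surf_nonneg (h : IsGaussLobatto S.ξ) {f : FNode N → ℝ} (hf : ∀ y, 0 ≤ f y) :
    0 ≤ S.surf f :=
  Finset.sum_nonneg fun y _ => mul_nonneg (wt2_pos h y).le (hf y)

theorem surf_add (f g : FNode N → ℝ) : S.surf (fun y => f y + g y) = S.surf f + S.surf g := by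
  simp [surf, mul_add, Finset.sum_add_distrib]

theorem surf_sub (f g : FNode N → ℝ) : S.surf (fun y => f y - g y) = S.surf f - S.surf g := by
  simp [surf, mul_sub, Finset.sum_sub_distrib]

theorem surf_neg (f : FNode N → ℝ) : S.surf (fun y => -f y) = -S.surf f := by
  simp [surf]

theorem bsurf_add (e : E) (f g : EFace E → FNode N → ℝ) :
    S.bsurf e (fun F y => f F y + g F y) = S.bsurf e f + S.bsurf e g := by
  simp only [bsurf, surf_add, Finset.sum_add_distrib]

theorem bsurf_sub (e : E) (f g : EFace E → FNode N → ℝ) :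
    S.bsurf e (fun F y => f F y - g F y) = S.bsurf e f - S.bsurf e g := by
  simp only [bsurf, surf_sub, Finset.sum_sub_distrib]

theorem bsurf_congr {e : E} {f g : EFace E → FNode N → ℝ}
    (h : ∀ d s y, f (e, d, s) y = g (e, d, s) y) : S.bsurf e f = S.bsurf e g := by
  simp only [bsurf, surf, h]

/-- The outward flux through the boundary of an element. -/
theorem bsurf_flux (e : E) (H : Node N → Fin 3 → ℝ) :
    S.bsurf e (fun f y => S.nv f y ⬝ᵥ H (node f y))
      = ∑ d, ∑ m, ∑ y, wt2 S.ξ y *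
          (S.Ja e d m (faceNode d true y) * H (faceNode d true y) m
            - S.Ja e d m (faceNode d false y) * H (faceNode d false y) m) := by
  simp only [bsurf]
  refine Finset.sum_congr rfl fun d _ => ?_
  rw [Fintype.sum_bool, ← surf_add, Finset.sum_comm]
  refine Finset.sum_congr rfl fun y _ => ?_
  rw [← Finset.mul_sum]
  congr 1
  simp only [dotProduct, nv, nvec, node, Ja, ← Finset.sum_add_distrib]
  refine Finset.sum_congr rfl fun m _ => ?_
  simp
  ring

end Quadrature

/-! ### Summation by parts and the inviscid entropy balance within one element. -/

section Element

/-- Summation by parts for a scalar against a contravariant flux. -/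
theorem vol_div_add_vol_grad (h : IsGaussLobatto S.ξ) (e : E) (w : Node N → State)
    (F : Node N → Block) :
    S.vol (fun x => ∑ a, w x a * ∑ d, pd S.ξ d (fun z => S.tilde e F z d a) x)
      + S.vol (fun x => ∑ d, ∑ a, S.tilde e F x d a * pd S.ξ d (fun z => w z a) x)
      = S.bsurf e (fun f y => w (node f y) ⬝ᵥ ndot (S.nv f y) (F (node f y))) := by
  have h1 : S.bsurf e (fun f y => w (node f y) ⬝ᵥ ndot (S.nv f y) (F (node f y)))
      = ∑ d, ∑ a, ∑ y, wt2 S.ξ y *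
          (w (faceNode d true y) a * S.tilde e F (faceNode d true y) d a
            - w (faceNode d false y) a * S.tilde e F (faceNode d false y) d a) := by
    simp only [dot_ndot]
    refine (bsurf_flux (S := S) e fun x m => w x ⬝ᵥ F x m).trans ?_
    refine Finset.sum_congr rfl fun d _ => ?_
    rw [Finset.sum_comm, Finset.sum_comm (s := (Finset.univ : Finset (Fin 5)))]
    refine Finset.sum_congr rfl fun y _ => ?_
    simp only [← Finset.mul_sum, Finset.sum_sub_distrib]
    congr 2 <;> simp only [tilde, dotProduct, Finset.mul_sum] <;> rw [Finset.sum_comm] <;>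
      exact Finset.sum_congr rfl fun _ _ => Finset.sum_congr rfl fun _ _ => by ring
  rw [h1]
  rw [Finset.sum_congr rfl fun d _ => Finset.sum_congr rfl fun a _ =>
    (sbp_mul h d (fun z => w z a) (fun z => S.tilde e F z d a)).symm]
  simp only [vol, Finset.mul_sum, Finset.sum_add_distrib]
  congr 1
  · rw [Finset.sum_comm, Finset.sum_congr rfl fun _ _ => Finset.sum_comm, Finset.sum_comm]
  · rw [Finset.sum_comm]
    exact Finset.sum_congr rfl fun _ _ => Finset.sum_comm

/-- Two-point form of the quadrature of `Wᵀ 𝔻(F^#)`. -/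
theorem vol_splitDiv (U : Snapshot N E) (e : E) :
    S.vol (fun x => S.splitDiv U e x ⬝ᵥ S.W U e x)
      = ∑ d, ∑ m, ∑ x, wt3 S.ξ x * ∑ n, dMat S.ξ (x d) n *
          (2 * (avg (S.Ja e d m x) (S.Ja e d m (Function.update x d n)) *
            (S.W U e x ⬝ᵥ twoPoint S.gas.γ S.kind (U.Q e x)
              (U.Q e (Function.update x d n)) m))) := by
  have h1 : ∀ x, S.splitDiv U e x ⬝ᵥ S.W U e x
      = ∑ d, ∑ m, ∑ n, dMat S.ξ (x d) n *
          (2 * (avg (S.Ja e d m x) (S.Ja e d m (Function.update x d n)) *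
            (S.W U e x ⬝ᵥ twoPoint S.gas.γ S.kind (U.Q e x)
              (U.Q e (Function.update x d n)) m))) := by
    intro x
    simp only [splitDiv, dotProduct, Finset.mul_sum, Finset.sum_mul]
    rw [Finset.sum_comm]
    refine Finset.sum_congr rfl fun d _ => ?_
    rw [Finset.sum_congr rfl fun _ _ => Finset.sum_comm, Finset.sum_comm]
    refine Finset.sum_congr rfl fun m _ => ?_
    rw [Finset.sum_comm]
    refine Finset.sum_congr rfl fun n _ => Finset.sum_congr rfl fun a _ => ?_
    ring
  simp only [vol, h1]
  simp only [Finset.mul_sum (s := (Finset.univ : Finset (Fin 3)))]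
  rw [Finset.sum_comm]
  exact Finset.sum_congr rfl fun _ _ => Finset.sum_comm

theorem presWork_eq (U : Snapshot N E) (e : E) :
    S.presWork U e
      = ∑ d, ∑ m, ∑ x, wt3 S.ξ x * ∑ n, dMat S.ξ (x d) n *
          (2 * (avg (S.Ja e d m x) (S.Ja e d m (Function.update x d n)) *
            (vel (U.Q e x) m * avg (pres S.gas.γ (U.Q e x))
              (pres S.gas.γ (U.Q e (Function.update x d n)))))) := by
  simp only [presWork, vol, Finset.mul_sum]
  rw [Finset.sum_comm, Finset.sum_congr rfl fun _ _ => Finset.sum_comm, Finset.sum_comm]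
  refine Finset.sum_congr rfl fun d _ => Finset.sum_congr rfl fun m _ =>
    Finset.sum_congr rfl fun x _ => Finset.sum_congr rfl fun n _ => ?_
  ring

/-- Entropy balance of the split-form divergence in one element. -/
theorem splitDiv_balance (h : IsGaussLobatto S.ξ) (hγ : 1 < S.gas.γ) {e : E}
    (hU : ∀ x, Admissible S.gas.γ (U.Q e x)) :
    S.vol (fun x => S.splitDiv U e x ⬝ᵥ S.W U e x)
      = S.kind.theta * S.presWork U e
        + S.bsurf e (fun f y => S.nv f y ⬝ᵥ entFlux S.gas.γ S.kind (U.Q e (node f y))) := by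
  rw [vol_splitDiv]
  refine Eq.trans ?_ (congrArg (S.kind.theta * S.presWork U e + ·)
    (bsurf_flux (S := S) e fun x => entFlux S.gas.γ S.kind (U.Q e x)).symm)
  rw [presWork_eq]
  simp only [W]
  cases hk : S.kind
  · simp only [EntropyKind.theta, one_mul, ← Finset.sum_add_distrib]
    refine Finset.sum_congr rfl fun d _ => Finset.sum_congr rfl fun m _ => ?_
    -- The convective part is symmetric in the two nodes, so the factor 2 of the split form is the
    -- sum of both orderings. The pressure part is the work term itself, so this case needs no
    -- metric identity.
    have hs := sbp_cube h d fun x z => avg (S.Ja e d m x) (S.Ja e d m z) *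
      (avg (U.Q e x 0) (U.Q e z 0) * avg (vel (U.Q e x) m) (vel (U.Q e z) m) *
        (vel (U.Q e x) ⬝ᵥ vel (U.Q e z)) / 2)
    simp only [avg_self] at hs
    have hf : ∀ q : State, entFlux S.gas.γ .kinetic q m = q 0 * vel q m * (vel q ⬝ᵥ vel q) / 2 :=
      fun q => by simp only [entFlux, entropy, kin]; ring
    simp only [hf, ← hs, ← Finset.sum_add_distrib, Finset.mul_sum]
    refine Finset.sum_congr rfl fun x _ => Finset.sum_congr rfl fun n _ => ?_
    rw [kinetic_dot_twoPoint, dotProduct_comm (vel (U.Q e (Function.update x d n))) (vel (U.Q e x))]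
    simp only [avg]
    ring
  · simp only [EntropyKind.theta, zero_mul, zero_add]
    have h1 : ∀ d m, ∑ x, wt3 S.ξ x * ∑ n, dMat S.ξ (x d) n *
          (2 * (avg (S.Ja e d m x) (S.Ja e d m (Function.update x d n)) *
            (entVar S.gas.γ .thermo (U.Q e x) ⬝ᵥ twoPoint S.gas.γ .thermo (U.Q e x)
              (U.Q e (Function.update x d n)) m)))
        = ∑ y, wt2 S.ξ y *
          (S.Ja e d m (faceNode d true y) * entFlux S.gas.γ .thermo (U.Q e (faceNode d true y)) m
            - S.Ja e d m (faceNode d false y)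
              * entFlux S.gas.γ .thermo (U.Q e (faceNode d false y)) m)
          + ∑ x, wt3 S.ξ x * (potential S.gas.γ .thermo (U.Q e x) m * pd S.ξ d (S.Ja e d m) x) := by
      intro d m
      have hs := sbp_cube h d fun x z => avg (S.Ja e d m x) (S.Ja e d m z) *
        (entVar S.gas.γ .thermo (U.Q e x) ⬝ᵥ twoPoint S.gas.γ .thermo (U.Q e x) (U.Q e z) m)
      have ha := sbp_avg_sub h d (S.Ja e d m) fun x => potential S.gas.γ .thermo (U.Q e x) m
      have hself : ∀ x, entVar S.gas.γ .thermo (U.Q e x)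
          ⬝ᵥ twoPoint S.gas.γ .thermo (U.Q e x) (U.Q e x) m
          = entFlux S.gas.γ .thermo (U.Q e x) m + potential S.gas.γ .thermo (U.Q e x) m := by
        intro x
        rw [twoPoint_self hγ (hU x), entVar_dot_eulerFlux hγ (hU x)]
      simp only [avg_self, hself] at hs
      -- With $2W_x=(W_x+W_z)-(W_z-W_x)$, the first part is symmetric and reduces to the faces. By
      -- entropy conservation the second is a difference of potentials, handled by `sbp_avg_sub`;
      -- its face terms cancel the potentials left by the first.
      have hsplit : ∀ x z, 2 * (avg (S.Ja e d m x) (S.Ja e d m z) *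
            (entVar S.gas.γ .thermo (U.Q e x) ⬝ᵥ
              twoPoint S.gas.γ .thermo (U.Q e x) (U.Q e z) m))
          = (avg (S.Ja e d m x) (S.Ja e d m z) *
              (entVar S.gas.γ .thermo (U.Q e x) ⬝ᵥ
                twoPoint S.gas.γ .thermo (U.Q e x) (U.Q e z) m)
            + avg (S.Ja e d m z) (S.Ja e d m x) *
              (entVar S.gas.γ .thermo (U.Q e z) ⬝ᵥ
                twoPoint S.gas.γ .thermo (U.Q e z) (U.Q e x) m))
            + avg (S.Ja e d m x) (S.Ja e d m z) *
              (potential S.gas.γ .thermo (U.Q e x) m - potential S.gas.γ .thermo (U.Q e z) m) := by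
        intro x z
        have hj := twoPoint_jump hγ .thermo (hU x) (hU z) m
        rw [sub_dotProduct, EntropyKind.theta, zero_mul, sub_zero] at hj
        rw [twoPoint_comm (q := U.Q e z), avg_comm (S.Ja e d m z)]
        linear_combination (-avg (S.Ja e d m x) (S.Ja e d m z)) * hj
      simp only [hsplit]
      simp only [mul_add (dMat _ _ _), Finset.sum_add_distrib, mul_add (wt3 _ _)] at hs ⊢
      rw [hs, ha, ← add_assoc, ← sub_eq_add_neg, ← Finset.sum_sub_distrib]
      congr 1
      exact Finset.sum_congr rfl fun y _ => by ring
    simp only [h1, Finset.sum_add_distrib]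
    -- The leftover volume term is the potential times the discrete divergence of the metric terms.
    refine (add_eq_left.2 ?_)
    rw [Finset.sum_comm, Finset.sum_congr rfl fun _ _ => Finset.sum_comm]
    refine Finset.sum_eq_zero fun m _ => Finset.sum_eq_zero fun x _ => ?_
    have hm : ∑ d, pd S.ξ d (S.Ja e d m) x = 0 := metric_identity (S.mesh.X e) m x
    rw [← Finset.mul_sum, ← Finset.mul_sum, hm, mul_zero, mul_zero]

end Element

end Setup

end DGSEM

namespace DGSEM

namespace Setup

variable {N : ℕ} {E Fi Fb : Type*} {S : Setup N E Fi Fb} {U : Snapshot N E}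

/-! ### From element boundaries to faces of the mesh. -/

section Faces

theorem across_left (i : Fi) (y : FNode N) :
    S.across (S.left i) y = .inl (S.right i, S.orient i y) := by
  simp [across, left]

theorem across_right (i : Fi) (y : FNode N) :
    S.across (S.right i) (S.orient i y) = .inl (S.left i, y) := by
  simp [across, right]

theorem across_bdry (b : Fb) (y : FNode N) : S.across (S.bdry b) y = .inr b := by
  simp [across, bdry]

theorem nv_right (i : Fi) (y : FNode N) : S.nv (S.right i) (S.orient i y) = -S.nv (S.left i) y :=
  S.mesh.opposite i y

/-- The two sides of a face may be numbered in reversed directions, so the surface quadratures agree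
only because the one-dimensional weights are symmetric. -/
theorem wt2_orient (h : IsGaussLobatto S.ξ) (i : Fi) (y : FNode N) :
    wt2 S.ξ (S.orient i y) = wt2 S.ξ y := by
  have h1 : ∀ a, wt S.ξ (S.orient i y a) = wt S.ξ (y (S.mesh.perm i a)) := by
    intro a
    simp only [orient, squareSymm, Equiv.trans_apply, Equiv.piCongrRight_apply, Pi.map_apply]
    split_ifs
    · exact wt_rev h _
    · rfl
  simp only [wt2, h1]
  exact Equiv.prod_comp (S.mesh.perm i) fun a => wt S.ξ (y a)

theorem surf_orient (h : IsGaussLobatto S.ξ) (i : Fi) (φ : FNode N → ℝ) :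
    S.surf (fun y => φ (S.orient i y)) = S.surf φ := by
  unfold surf
  rw [← (S.orient i).sum_comp fun y => wt2 S.ξ y * φ y]
  simp only [wt2_orient h]

/-- Sums over the element boundaries are sums over the faces of the mesh. -/
theorem sum_bsurf [Fintype E] [Fintype Fi] [Fintype Fb] (h : IsGaussLobatto S.ξ)
    (φ : EFace E → FNode N → ℝ) :
    ∑ e, S.bsurf e φ
      = ∑ i, S.surf (fun y => φ (S.left i) y + φ (S.right i) (S.orient i y))
        + ∑ b, S.surf (φ (S.bdry b)) := by
  have h1 : ∑ e, S.bsurf e φ = ∑ f : EFace E, S.surf (φ f) := by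
    simp only [bsurf, Fintype.sum_prod_type]
  rw [h1, ← S.mesh.faces.sum_comp, Fintype.sum_sum_type, Fintype.sum_sum_type]
  simp only [surf_add, Finset.sum_add_distrib]
  congr 2
  exact Finset.sum_congr rfl fun i _ => (surf_orient h i _).symm

end Faces

/-! ### Interior-face and wall terms. -/

section BoundaryTerms

/-- The boundary density of the inviscid entropy balance of an element. -/
noncomputable def inviscidDensity (S : Setup N E Fi Fb) (U : Snapshot N E) (f : EFace E)
    (y : FNode N) : ℝ :=
  entFlux S.gas.γ S.kind (U.Q f.1 (node f y)) ⬝ᵥ S.nv f y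
    + S.W U f.1 (node f y) ⬝ᵥ S.Festar U f y
    - S.W U f.1 (node f y) ⬝ᵥ ndot (S.nv f y) (S.Fe U f.1 (node f y))

/-- The boundary density of a viscous or artificial flux. -/
noncomputable def viscousDensity (S : Setup N E Fi Fb) (U : Snapshot N E)
    (F : E → Node N → Block) (f : EFace E) (y : FNode N) : ℝ :=
  S.W U f.1 (node f y) ⬝ᵥ S.Fstar F f y
    + S.Wstar U f y ⬝ᵥ ndot (S.nv f y) (F f.1 (node f y))
    - S.W U f.1 (node f y) ⬝ᵥ ndot (S.nv f y) (F f.1 (node f y))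

theorem Festar_left (i : Fi) (y : FNode N) :
    S.Festar U (S.left i) y = numFlux S.gas.γ S.kind S.iface (S.nv (S.left i) y)
      (S.QL U i y) (S.QR U i y) := by
  simp only [Festar, across_left]; rfl

theorem Festar_right (hc : S.iface.Proper S.gas.γ) (i : Fi) (y : FNode N) :
    S.Festar U (S.right i) (S.orient i y) = -S.Festar U (S.left i) y := by
  rw [Festar_left, ← numFlux_swap _ hc]
  simp only [Festar, across_right, nv_right]; rfl

theorem Fstar_left (F : E → Node N → Block) (i : Fi) (y : FNode N) :
    S.Fstar F (S.left i) y = fun a =>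
      avg (ndot (S.nv (S.left i) y) (F (S.left i).1 (node (S.left i) y)) a)
        (ndot (S.nv (S.left i) y) (F (S.right i).1 (node (S.right i) (S.orient i y))) a) := by
  simp only [Fstar, across_left]
  ext a
  simp only [ndot, avg, Fin.sum_univ_three]
  ring

theorem Fstar_right (F : E → Node N → Block) (i : Fi) (y : FNode N) :
    S.Fstar F (S.right i) (S.orient i y) = -S.Fstar F (S.left i) y := by
  simp only [Fstar, across_right, across_left, nv_right, ndot_neg]
  congr 2
  ext d a
  exact avg_comm _ _

theorem Wstar_left (i : Fi) (y : FNode N) :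
    S.Wstar U (S.left i) y = fun a => avg (S.WL U i y a) (S.WR U i y a) := by
  simp only [Wstar, across_left]; rfl

theorem Wstar_right (i : Fi) (y : FNode N) :
    S.Wstar U (S.right i) (S.orient i y) = S.Wstar U (S.left i) y := by
  simp only [Wstar, across_right, across_left]
  ext a
  exact avg_comm _ _

/-- The product rule $[\![ab]\!]=[\![a]\!]\{\!\{b\}\!\}+\{\!\{a\}\!\}[\![b]\!]$, by which BR1
averages produce no entropy for any flux. -/
theorem avg_jump (w z f g : State) :
    (z - w) ⬝ᵥ (fun a => avg (f a) (g a)) + (fun a => avg (w a) (z a)) ⬝ᵥ (g - f)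
      - (z ⬝ᵥ g - w ⬝ᵥ f) = 0 := by
  simp only [dotProduct, Pi.sub_apply, ← Finset.sum_add_distrib, ← Finset.sum_sub_distrib]
  exact Finset.sum_eq_zero fun a _ => by simp only [avg]; ring

theorem ibt_eq_zero [Fintype Fi] (F : E → Node N → Block) : S.ibt U F = 0 := by
  refine Finset.sum_eq_zero fun i _ => Finset.sum_eq_zero fun y _ => ?_
  simp only [Fstar_left, Wstar_left, avg_jump, mul_zero]

/-- In each component one of $W^\star$ and $F^\star$ keeps the inner value and the other is zero, so
exactly one copy of the inner product survives. -/
theorem wall_balance (k : Wall) (w f : State) :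
    w ⬝ᵥ wallFlux k f + wallW k w ⬝ᵥ f - w ⬝ᵥ f = 0 := by
  cases k
  · simp [wallFlux, wallW]
  · simp only [dot5, wallFlux, wallW, pack_zero, pack_four, mid_pack, zero_dotProduct]
    ring

theorem viscousDensity_bdry (F : E → Node N → Block) (b : Fb) (y : FNode N) :
    S.viscousDensity U F (S.bdry b) y = 0 := by
  simp only [viscousDensity, Fstar, Wstar, across_bdry, wall_balance]

theorem pbt_eq_zero [Fintype Fb] (F : E → Node N → Block) : S.pbt U F = 0 := by
  have : S.pbt U F = -∑ b, S.surf (S.viscousDensity U F (S.bdry b)) := rfl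
  rw [this]
  simp [surf, viscousDensity_bdry]

theorem viscousDensity_interior (F : E → Node N → Block) (i : Fi) (y : FNode N) :
    S.viscousDensity U F (S.left i) y
      + S.viscousDensity U F (S.right i) (S.orient i y) = 0 := by
  have h := avg_jump (S.WL U i y) (S.WR U i y)
    (ndot (S.nv (S.left i) y) (F (S.left i).1 (node (S.left i) y)))
    (ndot (S.nv (S.left i) y) (F (S.right i).1 (node (S.right i) (S.orient i y))))
  rw [← Fstar_left, ← Wstar_left, sub_dotProduct, dotProduct_sub] at h
  have hL : S.W U (S.left i).1 (node (S.left i) y) = S.WL U i y := rfl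
  have hR : S.W U (S.right i).1 (node (S.right i) (S.orient i y)) = S.WR U i y := rfl
  simp only [viscousDensity, Fstar_right, Wstar_right, nv_right, ndot_neg, dotProduct_neg, hL, hR]
  linarith

theorem sum_bsurf_viscousDensity [Fintype E] [Fintype Fi] [Fintype Fb]
    (h : IsGaussLobatto S.ξ) (F : E → Node N → Block) :
    ∑ e, S.bsurf e (S.viscousDensity U F) = 0 := by
  rw [sum_bsurf h]
  simp [viscousDensity_interior, viscousDensity_bdry, surf]

/-- Normal and numerical flux change sign across a face, so the two one-sided densities add up to
minus the jump expression. -/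
theorem sum_bsurf_inviscidDensity [Fintype E] [Fintype Fi] [Fintype Fb]
    (h : IsGaussLobatto S.ξ) (hc : S.iface.Proper S.gas.γ) :
    ∑ e, S.bsurf e (S.inviscidDensity U) = S.ibtE U + S.pbtE U := by
  rw [sum_bsurf h]
  have h2 : S.pbtE U = ∑ b, S.surf (S.inviscidDensity U (S.bdry b)) := rfl
  rw [h2, ibtE, ← Finset.sum_neg_distrib]
  congr 1
  refine Finset.sum_congr rfl fun i _ => ?_
  rw [← surf_neg]
  congr 1
  ext y
  have hL : S.W U (S.left i).1 (node (S.left i) y) = S.WL U i y := rfl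
  have hR : S.W U (S.right i).1 (node (S.right i) (S.orient i y)) = S.WR U i y := rfl
  have hL' : U.Q (S.left i).1 (node (S.left i) y) = S.QL U i y := rfl
  have hR' : U.Q (S.right i).1 (node (S.right i) (S.orient i y)) = S.QR U i y := rfl
  simp only [inviscidDensity, Festar_right hc, nv_right, ndot_neg, dotProduct_neg, hL, hR, Fe,
    hL', hR', sub_dotProduct]
  ring

/-- The inviscid terms at an interior face reduce to the numerical dissipation and the work of the
pressure jump. -/
theorem inviscid_jump (hγ : 1 < S.gas.γ) (hU : ∀ e x, Admissible S.gas.γ (U.Q e x)) (i : Fi)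
    (y : FNode N) :
    (entFlux S.gas.γ S.kind (S.QR U i y) - entFlux S.gas.γ S.kind (S.QL U i y))
        ⬝ᵥ S.nv (S.left i) y
      + (S.WR U i y - S.WL U i y) ⬝ᵥ S.Festar U (S.left i) y
      - (S.WR U i y ⬝ᵥ ndot (S.nv (S.left i) y) (eulerFlux S.gas.γ (S.QR U i y))
        - S.WL U i y ⬝ᵥ ndot (S.nv (S.left i) y) (eulerFlux S.gas.γ (S.QL U i y)))
      = -(S.kind.theta * ((∑ m, avg (vel (S.QL U i y) m) (vel (S.QR U i y) m)
            * S.nv (S.left i) y m) *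
          (pres S.gas.γ (S.QR U i y) - pres S.gas.γ (S.QL U i y))))
        - area (S.nv (S.left i) y) / 2 * ((S.WR U i y - S.WL U i y) ⬝ᵥ
          dissip S.gas.γ S.kind S.iface (unit (S.nv (S.left i) y)) (S.QL U i y) (S.QR U i y)) := by
  have hq : Admissible S.gas.γ (S.QL U i y) := hU _ _
  have hr : Admissible S.gas.γ (S.QR U i y) := hU _ _
  rw [Festar_left, numFlux, dotProduct_sub, dotProduct_smul, smul_eq_mul, dot_ndot, dot_ndot,
    dot_ndot]
  simp only [WL, WR, twoPoint_jump hγ _ hq hr, entVar_dot_eulerFlux hγ hq,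
    entVar_dot_eulerFlux hγ hr]
  simp only [dot3, Fin.sum_univ_three, Pi.sub_apply]
  ring

theorem ibtE_sub_presWorkFaces [Fintype Fi] (hγ : 1 < S.gas.γ)
    (hU : ∀ e x, Admissible S.gas.γ (U.Q e x)) :
    S.ibtE U - S.kind.theta * S.presWorkFaces U
      = ∑ i, S.surf fun y => area (S.nv (S.left i) y) / 2 * ((S.WR U i y - S.WL U i y) ⬝ᵥ
          dissip S.gas.γ S.kind S.iface (unit (S.nv (S.left i) y)) (S.QL U i y) (S.QR U i y)) := by
  simp only [ibtE, inviscid_jump hγ hU, surf_sub, surf_neg, Finset.sum_sub_distrib,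
    Finset.sum_neg_distrib]
  have : S.kind.theta * S.presWorkFaces U = ∑ i, S.surf fun y => S.kind.theta *
      ((∑ m, avg (vel (S.QL U i y) m) (vel (S.QR U i y) m) * S.nv (S.left i) y m) *
        (pres S.gas.γ (S.QR U i y) - pres S.gas.γ (S.QL U i y))) := by
    simp only [presWorkFaces, surf, Finset.mul_sum]
    exact Finset.sum_congr rfl fun _ _ => Finset.sum_congr rfl fun _ _ => by ring
  rw [this]
  ring

theorem ibtE_nonneg [Fintype Fi] (h : IsGaussLobatto S.ξ) (hγ : 1 < S.gas.γ)
    (hc : S.iface.Proper S.gas.γ) (hU : ∀ e x, Admissible S.gas.γ (U.Q e x)) :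
    0 ≤ S.ibtE U - S.kind.theta * S.presWorkFaces U := by
  rw [ibtE_sub_presWorkFaces hγ hU]
  exact Finset.sum_nonneg fun i _ => surf_nonneg h fun y =>
    mul_nonneg (div_nonneg (area_nonneg _) two_pos.le)
      (dissip_nonneg hγ _ hc (hU _ _) (hU _ _) _)

theorem dissip_conserving (γ : ℝ) (k : EntropyKind) (n : Fin 3 → ℝ) (q r : State) :
    dissip γ k .conserving n q r = 0 := by
  cases k <;> rfl

theorem ibtE_conserving [Fintype Fi] (hγ : 1 < S.gas.γ) (hc : S.iface = .conserving)
    (hU : ∀ e x, Admissible S.gas.γ (U.Q e x)) :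
    S.ibtE U = S.kind.theta * S.presWorkFaces U := by
  rw [← sub_eq_zero, ibtE_sub_presWorkFaces hγ hU]
  simp [hc, dissip_conserving, surf]

theorem inviscidDensity_bdry (hγ : 1 < S.gas.γ) (hc : S.iface.Proper S.gas.γ)
    (hU : ∀ e x, Admissible S.gas.γ (U.Q e x)) (b : Fb) (y : FNode N) :
    0 ≤ S.inviscidDensity U (S.bdry b) y ∧
      (S.iface = .conserving → S.inviscidDensity U (S.bdry b) y = 0) := by
  have hq := hU (S.bdry b).1 (node (S.bdry b) y)
  have h1 := numFlux_ghost hγ S.kind hc hq (S.nv (S.bdry b) y)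
  have h2 : S.inviscidDensity U (S.bdry b) y
      = entVar S.gas.γ S.kind (U.Q (S.bdry b).1 (node (S.bdry b) y)) ⬝ᵥ
          numFlux S.gas.γ S.kind S.iface (S.nv (S.bdry b) y)
            (U.Q (S.bdry b).1 (node (S.bdry b) y))
            (ghost (unit (S.nv (S.bdry b) y)) (U.Q (S.bdry b).1 (node (S.bdry b) y)))
        - S.nv (S.bdry b) y ⬝ᵥ
          potential S.gas.γ S.kind (U.Q (S.bdry b).1 (node (S.bdry b) y)) := by
    simp only [inviscidDensity, Festar, across_bdry, W, Fe, dot_ndot, entVar_dot_eulerFlux hγ hq]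
    simp only [dot3, Fin.sum_univ_three]
    ring
  rw [h2]
  exact ⟨sub_nonneg.2 h1.1, fun hh => sub_eq_zero.2 (h1.2 hh)⟩

theorem pbtE_nonneg [Fintype Fb] (h : IsGaussLobatto S.ξ) (hγ : 1 < S.gas.γ)
    (hc : S.iface.Proper S.gas.γ) (hU : ∀ e x, Admissible S.gas.γ (U.Q e x)) :
    0 ≤ S.pbtE U :=
  Finset.sum_nonneg fun b _ => surf_nonneg h fun y => (inviscidDensity_bdry hγ hc hU b y).1

theorem pbtE_conserving [Fintype Fb] (hγ : 1 < S.gas.γ) (hc : S.iface.Proper S.gas.γ)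
    (hcons : S.iface = .conserving) (hU : ∀ e x, Admissible S.gas.γ (U.Q e x)) :
    S.pbtE U = 0 := by
  have h2 : S.pbtE U = ∑ b, S.surf (S.inviscidDensity U (S.bdry b)) := rfl
  rw [h2]
  refine Finset.sum_eq_zero fun b _ => Finset.sum_eq_zero fun y _ => ?_
  rw [(inviscidDensity_bdry hγ hc hU b y).2 hcons, mul_zero]

end BoundaryTerms

/-! ### Element balance, signs of the volume dissipation and the global entropy balance. -/

section Balance

/-- For the kinetic energy, the energy component of the discrete gradient vanishes. -/
theorem gradient_energy_eq_zero (h : IsGaussLobatto S.ξ) (hk : S.kind = .kinetic) {e : E}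
    (hG : S.GradEq U e) (x : Node N) (d : Fin 3) : U.G e x d 4 = 0 := by
  classical
  -- The test field is a Kronecker delta in node, direction and energy component. Since $W$ and
  -- $W^\star$ have no energy component, only $\mathcal J$ times the weight times the sought entry
  -- remains.
  have h1 := hG fun z d' => pack 0 0 (if z = x ∧ d' = d then 1 else 0)
  have hW4 : ∀ f y, S.Wstar U f y 4 = 0 := by
    intro f y
    have hwall : ∀ k w, wallW k w 4 = w 4 := fun k w => by cases k <;> rfl
    simp only [Wstar, W, hk]
    cases S.across f y with
    | inl o => simp [entVar, avg]
    | inr b => exact hwall _ _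
  have hdot : ∀ (w : State) c, w ⬝ᵥ pack 0 0 c = w 4 * c := fun w c => by
    rw [dot5]; simp
  have htilde : ∀ z d' a, a ≠ 4 → S.tilde e (fun z d' => pack 0 0
      (if z = x ∧ d' = d then 1 else 0)) z d' a = 0 := by
    intro z d' a ha
    have hp : ∀ c : ℝ, pack 0 0 c a = 0 := fun c => by
      fin_cases a <;> first | rfl | exact absurd rfl ha
    simp [tilde, hp]
  have hW : ∀ z a, S.W U e z a * ∑ d', pd S.ξ d' (fun z => S.tilde e (fun z d' => pack 0 0
      (if z = x ∧ d' = d then 1 else 0)) z d' a) z = 0 := by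
    intro z a
    by_cases ha : a = 4
    · have : S.W U e z a = 0 := by rw [ha, W, hk]; rfl
      rw [this, zero_mul]
    · simp [htilde _ _ _ ha, pd]
  simp only [hW, dot_ndot, hdot, hW4] at h1
  have hw := (wt3_pos h x).ne'
  have hJ : S.J e x ≠ 0 := (S.mesh.jac_pos e x).ne'
  simpa [vol, bsurf, surf, ite_and, hw, hJ] using h1

/-- The entropy balance of one element. -/
theorem element_balance (h : IsGaussLobatto S.ξ) (hγ : 1 < S.gas.γ) {e : E}
    (hU : ∀ x, Admissible S.gas.γ (U.Q e x)) (hG : S.GradEq U e) (hE : S.EvolEq U e) :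
    S.vol (fun x => S.J e x * (U.Qt e x ⬝ᵥ S.W U e x)) + S.kind.theta * S.presWork U e
        + S.bsurf e (S.inviscidDensity U)
      = S.bsurf e (S.viscousDensity U (S.Fv U)) + S.bsurf e (S.viscousDensity U (S.Fa U))
        - S.volDiss U (S.Fv U) e - S.volDiss U (S.Fa U) e := by
  -- The evolution equation is tested with $W$ and the gradient equation with the total viscous
  -- flux. Both contain a volume integral of $W$ against that flux, one in gradient and one in
  -- divergence form, and `h3` eliminates them.
  have h1 := hE (S.W U e)
  have h2 := hG fun x => S.Fv U e x + S.Fa U e x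
  have h3 := vol_div_add_vol_grad h e (S.W U e) fun x => S.Fv U e x + S.Fa U e x
  have h4 := splitDiv_balance h hγ hU
  have h5 : S.vol (fun x => S.J e x * ∑ d, U.G e x d ⬝ᵥ (S.Fv U e x + S.Fa U e x) d)
      = S.volDiss U (S.Fv U) e + S.volDiss U (S.Fa U) e := by
    simp only [volDiss, ← vol_add, Pi.add_apply, dotProduct_add, Finset.sum_add_distrib, mul_add]
  have h6 : S.bsurf e (S.inviscidDensity U)
      = S.bsurf e (fun f y => S.W U e (node f y) ⬝ᵥ
            (S.Festar U f y - ndot (S.nv f y) (S.Fe U e (node f y))))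
        + S.bsurf e (fun f y => S.nv f y ⬝ᵥ entFlux S.gas.γ S.kind (U.Q e (node f y))) := by
    rw [← bsurf_add]
    refine bsurf_congr fun d s y => ?_
    simp only [inviscidDensity, dotProduct_sub, dotProduct_comm (S.nv _ _) (entFlux _ _ _)]
    ring
  have h7 : S.bsurf e (S.viscousDensity U (S.Fv U)) + S.bsurf e (S.viscousDensity U (S.Fa U))
      = S.bsurf e (fun f y => S.W U e (node f y) ⬝ᵥ
            (S.Fstar (S.Fv U) f y + S.Fstar (S.Fa U) f y))
        + S.bsurf e (fun f y => S.Wstar U f y ⬝ᵥ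
            ndot (S.nv f y) (S.Fv U e (node f y) + S.Fa U e (node f y)))
        - S.bsurf e (fun f y => S.W U e (node f y) ⬝ᵥ
            ndot (S.nv f y) (S.Fv U e (node f y) + S.Fa U e (node f y))) := by
    rw [← bsurf_add, ← bsurf_add, ← bsurf_sub]
    refine bsurf_congr fun d s y => ?_
    simp only [viscousDensity, ndot_add, dotProduct_add]
    ring
  linarith

theorem volDiss_Fv_nonneg (h : IsGaussLobatto S.ξ) (hγ : 1 < S.gas.γ) (hR : 0 < S.gas.R)
    (hPr : 0 < S.gas.Pr) (hμ : 0 ≤ S.gas.μ) {e : E}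
    (hU : ∀ x, Admissible S.gas.γ (U.Q e x)) (hG : S.GradEq U e) :
    0 ≤ S.volDiss U (S.Fv U) e :=
  vol_nonneg h fun x => mul_nonneg (S.mesh.jac_pos e x).le
    (viscFlux_dissipative hγ hR hPr hμ _ (hU x) _ _ fun hk => gradient_energy_eq_zero h hk hG x)

/-- For the kinetic energy the additional energy flux may be arbitrary: it meets the vanishing
energy component of the gradient. -/
theorem volDiss_Fa_nonneg (h : IsGaussLobatto S.ξ) {e : E} (hA : U.art.Nonneg)
    (hK : ∀ m, 0 ≤ U.kernel e m) (hG : S.GradEq U e) :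
    0 ≤ S.volDiss U (S.Fa U) e := by
  have h1 := filtFlux_dissipative h hK (S.mesh.jac_pos e) (U.G e) e hA
  refine h1.trans_eq ?_
  refine Finset.sum_congr rfl fun x _ => ?_
  congr 2
  refine Finset.sum_congr rfl fun d _ => ?_
  rw [Fa]
  cases hk : S.kind
  · have h4 := gradient_energy_eq_zero h hk hG x d
    have : ∀ c, U.G e x d ⬝ᵥ pack 0 0 c = 0 := fun c => by
      rw [dot5]; simp [h4]
    simp only [artFlux, dotProduct_add, this, add_zero]
    rfl
  · rfl

/-- The semi-discrete entropy balance. -/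
theorem entropy_balance [Fintype E] [Fintype Fi] [Fintype Fb] (h : IsGaussLobatto S.ξ)
    (hγ : 1 < S.gas.γ) (hc : S.iface.Proper S.gas.γ)
    (hU : ∀ e x, Admissible S.gas.γ (U.Q e x)) (hG : ∀ e, S.GradEq U e)
    (hE : ∀ e, S.EvolEq U e) :
    ∑ e, S.vol (fun x => S.J e x * (U.Qt e x ⬝ᵥ S.W U e x))
        + S.kind.theta * ∑ e, S.presWork U e
      = -S.ibtE U - S.pbtE U - ∑ e, S.volDiss U (S.Fv U) e - ∑ e, S.volDiss U (S.Fa U) e := by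
  have h1 := Finset.sum_congr rfl fun e (_ : e ∈ Finset.univ) =>
    element_balance h hγ (hU e) (hG e) (hE e)
  simp only [Finset.sum_add_distrib, Finset.sum_sub_distrib, sum_bsurf_viscousDensity h,
    sum_bsurf_inviscidDensity h hc, ← Finset.mul_sum] at h1
  linarith

theorem hasDerivWithinAt_totalEntropy [Fintype E] (hγ : 1 < S.gas.γ) {T : Set ℝ}
    {U : ℝ → Snapshot N E} (hU : S.IsSolution T U) {t : ℝ} (ht : t ∈ T) :
    HasDerivWithinAt (fun s => S.totalEntropy (U s).Q)
      (∑ e, S.vol (fun x => S.J e x * ((U t).Qt e x ⬝ᵥ S.W (U t) e x))) T t := by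
  unfold totalEntropy vol
  refine HasDerivWithinAt.fun_sum fun e _ => HasDerivWithinAt.fun_sum fun x _ => ?_
  exact ((hasDerivWithinAt_entropy hγ S.kind (fun a => hU.deriv t ht e x a)
    (hU.admissible t ht e x)).const_mul _).const_mul _

end Balance

end Setup

end DGSEM

open DGSEM DGSEM.Setup in
theorem mainTheorem1 {N : ℕ} {E Fi Fb : Type*} [Fintype E] [Fintype Fi] [Fintype Fb]
    (S : DGSEM.Setup N E Fi Fb)
    (hξ : DGSEM.IsGaussLobatto S.ξ)
    (hγ : 1 < S.gas.γ) (hR : 0 < S.gas.R) (hPr : 0 < S.gas.Pr) (hμ : 0 ≤ S.gas.μ)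
    (hface : S.iface.Proper S.gas.γ)
    (T : Set ℝ) (hT : T.OrdConnected)
    (U : ℝ → DGSEM.Snapshot N E)
    (hart : ∀ t ∈ T, (U t).art.Nonneg)
    (hker : ∀ t ∈ T, ∀ e m, 0 ≤ (U t).kernel e m)
    (hU : S.IsSolution T U) :
    (∀ t ∈ T,
      (∃ dE : ℝ,
        HasDerivWithinAt (fun s => S.totalEntropy (U s).Q) dE T t ∧
        dE + S.kind.theta * ∑ e, S.presWork (U t) e
          = -S.ibtE (U t) - S.pbtE (U t)
            - ∑ e, S.volDiss (U t) (S.Fv (U t)) e - ∑ e, S.volDiss (U t) (S.Fa (U t)) e ∧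
        dE + S.kind.theta * (∑ e, S.presWork (U t) e + S.presWorkFaces (U t)) ≤ 0) ∧
      0 ≤ S.ibtE (U t) - S.kind.theta * S.presWorkFaces (U t) ∧
      0 ≤ S.pbtE (U t) ∧
      (S.iface = .conserving →
        S.ibtE (U t) = S.kind.theta * S.presWorkFaces (U t) ∧ S.pbtE (U t) = 0) ∧
      (∀ e, 0 ≤ S.volDiss (U t) (S.Fv (U t)) e) ∧
      (∀ e, 0 ≤ S.volDiss (U t) (S.Fa (U t)) e) ∧
      S.ibt (U t) (S.Fv (U t)) = 0 ∧ S.ibt (U t) (S.Fa (U t)) = 0 ∧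
      S.pbt (U t) (S.Fv (U t)) = 0 ∧ S.pbt (U t) (S.Fa (U t)) = 0) ∧
    (S.kind = .thermo → AntitoneOn (fun t => S.totalEntropy (U t).Q) T) := by
  have hγU : ∀ t ∈ T, ∀ e x, Admissible S.gas.γ ((U t).Q e x) := hU.admissible
  have hdiss : ∀ t ∈ T, (∀ e, 0 ≤ S.volDiss (U t) (S.Fv (U t)) e) ∧
      ∀ e, 0 ≤ S.volDiss (U t) (S.Fa (U t)) e := fun t ht =>
    ⟨fun e => volDiss_Fv_nonneg hξ hγ hR hPr hμ (hγU t ht e) (hU.grad t ht e),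
      fun e => volDiss_Fa_nonneg hξ (hart t ht) (hker t ht e) (hU.grad t ht e)⟩
  have hbal : ∀ t ∈ T, ∃ dE : ℝ,
      HasDerivWithinAt (fun s => S.totalEntropy (U s).Q) dE T t ∧
      dE + S.kind.theta * ∑ e, S.presWork (U t) e
        = -S.ibtE (U t) - S.pbtE (U t)
          - ∑ e, S.volDiss (U t) (S.Fv (U t)) e - ∑ e, S.volDiss (U t) (S.Fa (U t)) e ∧
      dE + S.kind.theta * (∑ e, S.presWork (U t) e + S.presWorkFaces (U t)) ≤ 0 := by
    intro t ht
    have hb := entropy_balance hξ hγ hface (hγU t ht) (hU.grad t ht) (hU.evol t ht)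
    refine ⟨_, hasDerivWithinAt_totalEntropy hγ hU ht, hb, ?_⟩
    have h1 := ibtE_nonneg hξ hγ hface (hγU t ht)
    have h2 := pbtE_nonneg hξ hγ hface (hγU t ht)
    have h3 := Finset.sum_nonneg fun e (_ : e ∈ Finset.univ) => (hdiss t ht).1 e
    have h4 := Finset.sum_nonneg fun e (_ : e ∈ Finset.univ) => (hdiss t ht).2 e
    rw [mul_add]
    linarith
  refine ⟨fun t ht => ⟨hbal t ht, ibtE_nonneg hξ hγ hface (hγU t ht),
    pbtE_nonneg hξ hγ hface (hγU t ht),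
    fun hc => ⟨ibtE_conserving hγ hc (hγU t ht), pbtE_conserving hγ hface hc (hγU t ht)⟩,
    (hdiss t ht).1, (hdiss t ht).2, ibt_eq_zero _, ibt_eq_zero _, pbt_eq_zero _,
    pbt_eq_zero _⟩, fun hk => ?_⟩
  choose! dE hd _ hle using hbal
  -- The time interval may contain its end points: continuity on all of `T` and the sign of the
  -- derivative in the interior suffice.
  refine antitoneOn_of_hasDerivWithinAt_nonpos hT.convex
    (fun t ht => (hd t ht).continuousWithinAt)
    (fun t ht => (hd t (interior_subset ht)).mono interior_subset) fun t ht => ?_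
  simpa [hk, EntropyKind.theta] using hle t (interior_subset ht)
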